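/- **Theorem 3.3 (total geodesicity of $F$).** Let $(\overline M,g_1)$ be a Riemannian manifold with Levi-Civita connection $\nabla^{\overline M}$, and let $(M,\psi,\xi,\eta,g_2)$ be a Kenmotsu manifold with Levi-Civita connection $\nabla^{M}$, that is, an almost contact metric manifold ($\psi^2=-I+\eta\otimes\xi$, $\psi\xi=0$, $\eta\circ\psi=0$, $\eta(\xi)=1$, $g_2(\psi U,\psi W)=g_2(U,W)-\eta(U)\eta(W)$, $g_2(\psi U,W)=-g_2(U,\psi W)$, $\eta(U)=g_2(U,\xi)$) with $$(\nabla^M_U\psi)W=g_2(\psi U,W)\xi-\eta(W)\psi U,\qquad \nabla^M_U\xi=U-\eta(U)\xi .$$ Let $F:\overline M\to M$ be a smooth Riemannian map, i.e. $g_2(F_*X,F_*Y)=g_1(X,Y)$ for $X,Y\in(\ker F_*)^\perp$, and suppose that $F$ is bi-slant with $\xi\in\Gamma(\operatorname{range}F_*)$: there is an orthogonal decomposition $$\operatorname{range}F_*=D_{\theta_1}\oplus D_{\theta_2}\oplus\langle\xi\rangle$$ into smooth distributions along $F$ such that $\psi D_{\theta_i}\perp D_{\theta_j}$ for $i\ne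 j$ and such that for every nonzero $w\in D_{\theta_i}$ the angle between $\psi w$ and $D_{\theta_i}$ is the constant $\theta_i$ ($i=1,2$). Let $\sigma$ be the orthogonal projection onto $D_{\theta_1}$, and let $\nabla^F$ be the pullback of $\nabla^M$ to $F^*TM$. Write $\psi W=PW+QW$ for $W\in\operatorname{range}F_*$ and $\psi V=\phi V+\omega V$ for $V\in(\operatorname{range}F_*)^\perp$, where $PW,\phi V\in\operatorname{range}F_*$ and $QW,\omega V\in(\operatorname{range}F_*)^\perp$. For a section $V$ of $(\operatorname{range}F_*)^\perp$ let $\nabla^F_XV=-S_VF_*X+\nabla^{F\perp}_XV$ be the decomposition into components in $\operatorname{range}F_*$ and $(\operatorname{range}F_*)^\perp$. Then $F$ is totally geodesic, i.e. $(\nabla F_*)(X,Y)=\nabla^F_XF_*Y-F_*(\nabla^{\overline M}_XY)=0$ for all vector fields $X,Y$ on $\overline M$, if and only if the following three conditions hold: 1. for all $X,Y\in\Gamma((\ker F_*)^\perp)$ and all $V\in(\operatorname{range}F_*)^\perp$, $$(\cos^2\theta_2-\cos^2\theta_1)\,g_2(\nabla^F_X\sigma F_*Y,V)=\cos^2\theta_2\,g_2(\nabla^F_XF_*Y,V)-g_2(\nabla^{F\perp}_XQPF_*Y,V)-g_2(S_{QF_*Y}F_*X,\phi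 V)+g_2(\nabla^{F\perp}_XQF_*Y,\omega V);$$ 2. $\ker F_*$ is totally geodesic, i.e. $\nabla^{\overline M}_XY\in\Gamma(\ker F_*)$ for all $X,Y\in\Gamma(\ker F_*)$; 3. $(\ker F_*)^\perp$ is totally geodesic, i.e. $\nabla^{\overline M}_XY\in\Gamma((\ker F_*)^\perp)$ for all $X,Y\in\Gamma((\ker F_*)^\perp)$. -/

import Mathlib

open Bundle Manifold
open scoped ContDiff Topology

noncomputable section

namespace BiSlant

section Connection

variable {E : Type*} [NormedAddCommGroup E] [NormedSpace ℝ E] [FiniteDimensional ℝ E]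
  {M : Type*} [TopologicalSpace M] [ChartedSpace E M] [IsManifold 𝓘(ℝ, E) ∞ M]

instance instFiniteDimensionalTangentSpace (x : M) :
    FiniteDimensional ℝ (TangentSpace 𝓘(ℝ, E) x) :=
  inferInstanceAs (FiniteDimensional ℝ E)

/-- `Γ(TM)`: the vector field `X` is smooth. -/
def IsSmoothField (X : Π x : M, TangentSpace 𝓘(ℝ, E) x) : Prop :=
  ContMDiff 𝓘(ℝ, E) (𝓘(ℝ, E).prod 𝓘(ℝ, E)) ∞ (fun x => TotalSpace.mk' E x (X x))

variable [RiemannianBundle (fun x : M => TangentSpace 𝓘(ℝ, E) x)]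
  [IsContMDiffRiemannianBundle 𝓘(ℝ, E) ∞ E (fun x : M => TangentSpace 𝓘(ℝ, E) x)]

/-- `cov` is the Levi-Civita connection of the Riemannian metric of `M`: it is compatible with the
metric and torsion free. In Mathlib's convention `cov Y x (X x)` is `(∇_X Y)(x)`. -/
structure IsLeviCivita
    (cov : CovariantDerivative 𝓘(ℝ, E) E (fun x : M => TangentSpace 𝓘(ℝ, E) x)) : Prop where
  /-- `u ⟨Y, Z⟩ = ⟨∇_u Y, Z⟩ + ⟨Y, ∇_u Z⟩` -/
  metric : ∀ (x : M) (u : TangentSpace 𝓘(ℝ, E) x) (Y Z : Π x : M, TangentSpace 𝓘(ℝ, E) x),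
    MDifferentiableAt 𝓘(ℝ, E) (𝓘(ℝ, E).prod 𝓘(ℝ, E)) (fun x => TotalSpace.mk' E x (Y x)) x →
    MDifferentiableAt 𝓘(ℝ, E) (𝓘(ℝ, E).prod 𝓘(ℝ, E)) (fun x => TotalSpace.mk' E x (Z x)) x →
    mvfderiv 𝓘(ℝ, E) (fun x => (inner ℝ (Y x) (Z x) : ℝ)) x u
      = inner ℝ (cov Y x u) (Z x) + inner ℝ (Y x) (cov Z x u)
  torsion_free : cov.torsion = 0

/-- The distribution `D` on `M` is totally geodesic: `∇_X Y ∈ Γ(D)` for all `X, Y ∈ Γ(D)`. -/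
def IsTotallyGeodesicDistribution
    (cov : CovariantDerivative 𝓘(ℝ, E) E (fun x : M => TangentSpace 𝓘(ℝ, E) x))
    (D : Π x : M, Submodule ℝ (TangentSpace 𝓘(ℝ, E) x)) : Prop :=
  ∀ X Y : Π x : M, TangentSpace 𝓘(ℝ, E) x, IsSmoothField X → IsSmoothField Y →
    (∀ x, X x ∈ D x) → (∀ x, Y x ∈ D x) → ∀ x, cov Y x (X x) ∈ D x

/-- `(ψ, ξ, η)` together with the Riemannian metric of `M` is an almost contact metric structure. -/
structure IsAlmostContactMetric
    (ψ : Π x : M, TangentSpace 𝓘(ℝ, E) x →L[ℝ] TangentSpace 𝓘(ℝ, E) x)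
    (ξ : Π x : M, TangentSpace 𝓘(ℝ, E) x)
    (η : Π x : M, TangentSpace 𝓘(ℝ, E) x →L[ℝ] ℝ) : Prop where
  smooth_ψ : ContMDiff 𝓘(ℝ, E) (𝓘(ℝ, E).prod 𝓘(ℝ, E →L[ℝ] E)) ∞
    (fun x => TotalSpace.mk' (E →L[ℝ] E)
      (E := fun x : M => TangentSpace 𝓘(ℝ, E) x →L[ℝ] TangentSpace 𝓘(ℝ, E) x) x (ψ x))
  smooth_ξ : IsSmoothField ξ
  smooth_η : ContMDiff 𝓘(ℝ, E) (𝓘(ℝ, E).prod 𝓘(ℝ, E →L[ℝ] ℝ)) ∞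
    (fun x => TotalSpace.mk' (E →L[ℝ] ℝ)
      (E := fun x : M => TangentSpace 𝓘(ℝ, E) x →L[ℝ] Bundle.Trivial M ℝ x) x (η x))
  ψ_ψ : ∀ x (u : TangentSpace 𝓘(ℝ, E) x), ψ x (ψ x u) = -u + η x u • ξ x
  ψ_ξ : ∀ x, ψ x (ξ x) = 0
  η_ψ : ∀ x (u : TangentSpace 𝓘(ℝ, E) x), η x (ψ x u) = 0
  η_ξ : ∀ x, η x (ξ x) = 1
  inner_ψ_ψ : ∀ x (u v : TangentSpace 𝓘(ℝ, E) x),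
    inner ℝ (ψ x u) (ψ x v) = inner ℝ u v - η x u * η x v
  inner_ψ_left : ∀ x (u v : TangentSpace 𝓘(ℝ, E) x),
    inner ℝ (ψ x u) v = -inner ℝ u (ψ x v)
  η_eq_inner : ∀ x (u : TangentSpace 𝓘(ℝ, E) x), η x u = inner ℝ u (ξ x)

/-- `(M, ψ, ξ, η, g)` is a Kenmotsu manifold, where `cov` is the Levi-Civita connection of `g`.
Both identities are tensorial; they are stated at a point `x`, for a tangent vector `u` at `x` in
the place of `X`, and for a vector field `Y` that is differentiable at `x`. -/
structure IsKenmotsu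
    (cov : CovariantDerivative 𝓘(ℝ, E) E (fun x : M => TangentSpace 𝓘(ℝ, E) x))
    (ψ : Π x : M, TangentSpace 𝓘(ℝ, E) x →L[ℝ] TangentSpace 𝓘(ℝ, E) x)
    (ξ : Π x : M, TangentSpace 𝓘(ℝ, E) x)
    (η : Π x : M, TangentSpace 𝓘(ℝ, E) x →L[ℝ] ℝ) : Prop
    extends IsAlmostContactMetric ψ ξ η where
  leviCivita : IsLeviCivita cov
  /-- `(∇_X ψ) Y = ∇_X (ψ Y) - ψ (∇_X Y) = g(ψ X, Y) ξ - η(Y) ψ X` -/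
  cov_ψ : ∀ (x : M) (u : TangentSpace 𝓘(ℝ, E) x) (Y : Π x : M, TangentSpace 𝓘(ℝ, E) x),
    MDifferentiableAt 𝓘(ℝ, E) (𝓘(ℝ, E).prod 𝓘(ℝ, E)) (fun x => TotalSpace.mk' E x (Y x)) x →
    cov (fun x => ψ x (Y x)) x u - ψ x (cov Y x u)
      = (inner ℝ (ψ x u) (Y x) : ℝ) • ξ x - η x (Y x) • ψ x u
  /-- `∇_X ξ = X - η(X) ξ` -/
  cov_ξ : ∀ (x : M) (u : TangentSpace 𝓘(ℝ, E) x), cov ξ x u = u - η x u • ξ x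

end Connection

section Map

variable {E₁ : Type*} [NormedAddCommGroup E₁] [NormedSpace ℝ E₁] [FiniteDimensional ℝ E₁]
  {N : Type*} [TopologicalSpace N] [ChartedSpace E₁ N] [IsManifold 𝓘(ℝ, E₁) ∞ N]
  {E₂ : Type*} [NormedAddCommGroup E₂] [NormedSpace ℝ E₂] [FiniteDimensional ℝ E₂]
  {M : Type*} [TopologicalSpace M] [ChartedSpace E₂ M] [IsManifold 𝓘(ℝ, E₂) ∞ M]

/-- The differential `F_*` at `p`. -/
abbrev differential (F : N → M) (p : N) :
    TangentSpace 𝓘(ℝ, E₁) p →L[ℝ] TangentSpace 𝓘(ℝ, E₂) (F p) :=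
  mfderiv 𝓘(ℝ, E₁) 𝓘(ℝ, E₂) F p

/-- `ker F_*` at `p`. -/
def kerD (F : N → M) (p : N) : Submodule ℝ (TangentSpace 𝓘(ℝ, E₁) p) :=
  LinearMap.ker (differential (E₁ := E₁) (E₂ := E₂) F p).toLinearMap

/-- `range F_*` at `p`, a subspace of the tangent space of `M` at `F p`. -/
def rangeD (F : N → M) (p : N) : Submodule ℝ (TangentSpace 𝓘(ℝ, E₂) (F p)) :=
  LinearMap.range (differential (E₁ := E₁) (E₂ := E₂) F p).toLinearMap

/-- The vector field along `F` with components `F_* Y`. -/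
def pushforward (F : N → M) (Y : Π p : N, TangentSpace 𝓘(ℝ, E₁) p) (p : N) :
    TangentSpace 𝓘(ℝ, E₂) (F p) :=
  differential F p (Y p)

/-- The pullback connection `∇^F` along `F` of a connection on `TM`, acting on vector fields along
`F`, that is, on sections `V` of `F^* TM`. Write `V = ∑ Vⁱ (eᵢ ∘ F)` near `p`, for the local frame
`(eᵢ)` of `TM` obtained from the preferred trivialization at `F p` and a basis of the model space;
then `∇^F_u V = ∑ u(Vⁱ) eᵢ + ∑ Vⁱ(p) ∇_{F_* u} eᵢ`. The first sum is the derivative of the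
coordinate representation of `V`, and `∑ Vⁱ(p) eᵢ` is the extension of `V p` with constant
coordinates. -/
def pullbackCov
    (cov : CovariantDerivative 𝓘(ℝ, E₂) E₂ (fun x : M => TangentSpace 𝓘(ℝ, E₂) x))
    (F : N → M) (V : Π p : N, TangentSpace 𝓘(ℝ, E₂) (F p)) (p : N) :
    TangentSpace 𝓘(ℝ, E₁) p →L[ℝ] TangentSpace 𝓘(ℝ, E₂) (F p) :=
  ((trivializationAt E₂ (fun x : M => TangentSpace 𝓘(ℝ, E₂) x) (F p)).symmL ℝ (F p)).comp
      (mvfderiv 𝓘(ℝ, E₁) (fun q : N =>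
        (trivializationAt E₂ (fun x : M => TangentSpace 𝓘(ℝ, E₂) x) (F p)
          (TotalSpace.mk' E₂ (F q) (V q))).2) p)
    + (cov (FiberBundle.extend E₂ (V p)) (F p)).comp (differential F p)

/-- The second fundamental form `(∇F_*)(X, Y) = ∇^F_X F_* Y - F_* (∇_X Y)`. -/
def secondFundamentalForm
    (cov₁ : CovariantDerivative 𝓘(ℝ, E₁) E₁ (fun x : N => TangentSpace 𝓘(ℝ, E₁) x))
    (cov₂ : CovariantDerivative 𝓘(ℝ, E₂) E₂ (fun x : M => TangentSpace 𝓘(ℝ, E₂) x))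
    (F : N → M) (X Y : Π p : N, TangentSpace 𝓘(ℝ, E₁) p) (p : N) :
    TangentSpace 𝓘(ℝ, E₂) (F p) :=
  pullbackCov cov₂ F (pushforward F Y) p (X p) - differential F p (cov₁ Y p (X p))

/-- The map `F` is totally geodesic: `∇F_* = 0`. -/
def IsTotallyGeodesicMap
    (cov₁ : CovariantDerivative 𝓘(ℝ, E₁) E₁ (fun x : N => TangentSpace 𝓘(ℝ, E₁) x))
    (cov₂ : CovariantDerivative 𝓘(ℝ, E₂) E₂ (fun x : M => TangentSpace 𝓘(ℝ, E₂) x))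
    (F : N → M) : Prop :=
  ∀ X Y : Π p : N, TangentSpace 𝓘(ℝ, E₁) p, IsSmoothField X → IsSmoothField Y →
    ∀ p, secondFundamentalForm cov₁ cov₂ F X Y p = 0

/-- `D` is a smooth distribution along `F` (a smooth subbundle of `F^* TM`): near every point it
is spanned by a smooth local frame. -/
def IsSmoothDistributionAlong (F : N → M)
    (D : Π p : N, Submodule ℝ (TangentSpace 𝓘(ℝ, E₂) (F p))) : Prop :=
  ∀ p₀ : N, ∃ (k : ℕ) (s : Fin k → Π p : N, TangentSpace 𝓘(ℝ, E₂) (F p)),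
    ∀ᶠ p in 𝓝 p₀,
      (∀ i, ContMDiffAt 𝓘(ℝ, E₁) (𝓘(ℝ, E₂).prod 𝓘(ℝ, E₂)) ∞
        (fun q => TotalSpace.mk' E₂ (E := fun x : M => TangentSpace 𝓘(ℝ, E₂) x)
          (F q) (s i q)) p) ∧
      LinearIndependent ℝ (fun i => s i p) ∧
      Submodule.span ℝ (Set.range fun i => s i p) = D p

variable [RiemannianBundle (fun x : M => TangentSpace 𝓘(ℝ, E₂) x)]

section Source

variable [RiemannianBundle (fun x : N => TangentSpace 𝓘(ℝ, E₁) x)]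

/-- `(ker F_*)^⊥` at `p`. -/
def horD (F : N → M) (p : N) : Submodule ℝ (TangentSpace 𝓘(ℝ, E₁) p) :=
  (kerD (E₁ := E₁) (E₂ := E₂) F p)ᗮ

/-- `F` is a Riemannian map: it is smooth and `F_*` is isometric on `(ker F_*)^⊥`. -/
structure IsRiemannianMap (F : N → M) : Prop where
  smooth : ContMDiff 𝓘(ℝ, E₁) 𝓘(ℝ, E₂) ∞ F
  isometric : ∀ (p : N) (u v : TangentSpace 𝓘(ℝ, E₁) p),
    u ∈ horD (E₁ := E₁) (E₂ := E₂) F p → v ∈ horD (E₁ := E₁) (E₂ := E₂) F p →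
    (inner ℝ (differential (E₂ := E₂) F p u) (differential (E₂ := E₂) F p v) : ℝ) = inner ℝ u v

end Source

/-- Orthogonal projection of the tangent space of `M` at `F p` onto a subspace. -/
def proj {F : N → M} {p : N} (D : Submodule ℝ (TangentSpace 𝓘(ℝ, E₂) (F p))) :
    TangentSpace 𝓘(ℝ, E₂) (F p) →L[ℝ] TangentSpace 𝓘(ℝ, E₂) (F p) :=
  D.starProjection

/-- Component of `w` in `range F_*`. -/
def tanPart (F : N → M) (p : N) (w : TangentSpace 𝓘(ℝ, E₂) (F p)) :
    TangentSpace 𝓘(ℝ, E₂) (F p) :=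
  proj (rangeD (E₁ := E₁) F p) w

/-- Component of `w` in `(range F_*)^⊥`. -/
def norPart (F : N → M) (p : N) (w : TangentSpace 𝓘(ℝ, E₂) (F p)) :
    TangentSpace 𝓘(ℝ, E₂) (F p) :=
  proj (rangeD (E₁ := E₁) F p)ᗮ w

/-- The component of `ψ w` in `range F_*`. It is denoted `P w` for `w` in `range F_*`, and
`φ w` for `w` in `(range F_*)^⊥`. -/
def tanψ (F : N → M) (ψ : Π x : M, TangentSpace 𝓘(ℝ, E₂) x →L[ℝ] TangentSpace 𝓘(ℝ, E₂) x)
    (p : N) (w : TangentSpace 𝓘(ℝ, E₂) (F p)) : TangentSpace 𝓘(ℝ, E₂) (F p) :=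
  tanPart (E₁ := E₁) F p (ψ (F p) w)

/-- The component of `ψ w` in `(range F_*)^⊥`. It is denoted `Q w` for `w` in `range F_*`, and
`ω w` for `w` in `(range F_*)^⊥`. -/
def norψ (F : N → M) (ψ : Π x : M, TangentSpace 𝓘(ℝ, E₂) x →L[ℝ] TangentSpace 𝓘(ℝ, E₂) x)
    (p : N) (w : TangentSpace 𝓘(ℝ, E₂) (F p)) : TangentSpace 𝓘(ℝ, E₂) (F p) :=
  norPart (E₁ := E₁) F p (ψ (F p) w)

/-- The shape operator `S_V F_* u`, for `V` a section of `(range F_*)^⊥`: the vector `-S_V F_* u`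
is the component of `∇^F_u V` in `range F_*`. -/
def shapeOp
    (cov : CovariantDerivative 𝓘(ℝ, E₂) E₂ (fun x : M => TangentSpace 𝓘(ℝ, E₂) x))
    (F : N → M) (V : Π p : N, TangentSpace 𝓘(ℝ, E₂) (F p)) (p : N)
    (u : TangentSpace 𝓘(ℝ, E₁) p) : TangentSpace 𝓘(ℝ, E₂) (F p) :=
  -tanPart (E₁ := E₁) F p (pullbackCov cov F V p u)

/-- The normal connection `∇^{F⊥}_u V`, for `V` a section of `(range F_*)^⊥`: the component of
`∇^F_u V` in `(range F_*)^⊥`. -/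
def normalCov
    (cov : CovariantDerivative 𝓘(ℝ, E₂) E₂ (fun x : M => TangentSpace 𝓘(ℝ, E₂) x))
    (F : N → M) (V : Π p : N, TangentSpace 𝓘(ℝ, E₂) (F p)) (p : N)
    (u : TangentSpace 𝓘(ℝ, E₁) p) : TangentSpace 𝓘(ℝ, E₂) (F p) :=
  norPart (E₁ := E₁) F p (pullbackCov cov F V p u)

/-- `D` is a slant distribution along `F` with slant angle `θ`: for every nonzero `w` in `D`, the
angle between `ψ w` and the subspace `D` (the angle between `ψ w` and its orthogonal projection
onto `D`) equals `θ`. -/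
structure IsSlant (F : N → M)
    (ψ : Π x : M, TangentSpace 𝓘(ℝ, E₂) x →L[ℝ] TangentSpace 𝓘(ℝ, E₂) x)
    (D : Π p : N, Submodule ℝ (TangentSpace 𝓘(ℝ, E₂) (F p))) (θ : ℝ) : Prop where
  smooth : IsSmoothDistributionAlong (E₁ := E₁) F D
  angle_eq : ∀ (p : N), ∀ w ∈ D p, w ≠ 0 →
    InnerProductGeometry.angle (ψ (F p) w) (proj (D p) (ψ (F p) w)) = θ

variable [RiemannianBundle (fun x : N => TangentSpace 𝓘(ℝ, E₁) x)]

/-- `F` is a bi-slant Riemannian map with slant distributions `D₁`, `D₂` of slant angles `θ₁`, `θ₂`,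
in the case that `ξ` is tangent to `range F_*`:
`range F_* = D₁ ⊕ D₂ ⊕ ⟨ξ⟩` orthogonally, and `ψ Dᵢ ⊥ Dⱼ` for `i ≠ j`. -/
structure IsBiSlant (F : N → M)
    (ψ : Π x : M, TangentSpace 𝓘(ℝ, E₂) x →L[ℝ] TangentSpace 𝓘(ℝ, E₂) x)
    (ξ : Π x : M, TangentSpace 𝓘(ℝ, E₂) x)
    (D₁ D₂ : Π p : N, Submodule ℝ (TangentSpace 𝓘(ℝ, E₂) (F p))) (θ₁ θ₂ : ℝ) : Prop where
  riemannianMap : IsRiemannianMap (E₁ := E₁) (E₂ := E₂) F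
  slant₁ : IsSlant (E₁ := E₁) F ψ D₁ θ₁
  slant₂ : IsSlant (E₁ := E₁) F ψ D₂ θ₂
  orthogonal : ∀ p, D₁ p ⟂ D₂ p
  orthogonal_ξ₁ : ∀ p, D₁ p ⟂ Submodule.span ℝ {ξ (F p)}
  orthogonal_ξ₂ : ∀ p, D₂ p ⟂ Submodule.span ℝ {ξ (F p)}
  range_eq : ∀ p, rangeD (E₁ := E₁) F p = D₁ p ⊔ D₂ p ⊔ Submodule.span ℝ {ξ (F p)}
  ψ_orthogonal₁ : ∀ p, ∀ v ∈ D₁ p, ∀ w ∈ D₂ p, (inner ℝ (ψ (F p) v) w : ℝ) = 0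
  ψ_orthogonal₂ : ∀ p, ∀ v ∈ D₂ p, ∀ w ∈ D₁ p, (inner ℝ (ψ (F p) v) w : ℝ) = 0

end Map

end BiSlant

end

/-! Write `B = ∇F_*`. It is tensorial and, both connections being torsion free, symmetric, so it
vanishes iff it vanishes on pairs of horizontal or vertical fields (`(ker F_*)^⊥` or `ker F_*`). If
`Y` is vertical then `F_* Y = 0` and `B(X, Y) = -F_*(∇_X Y)`. Hence the vertical-vertical block
vanishes iff `ker F_*` is totally geodesic. By differentiating `⟪Y, Z⟫ = 0`, the mixed block
vanishes iff `(ker F_*)^⊥` is totally geodesic. On horizontal fields `⟪B(X, Y), F_* Z⟫` is symmetric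
in `X, Y` and skew in `Y, Z`, hence zero. So that block is normal to `range F_*` and vanishes iff
`⟪∇^F_X F_* Y, V⟫ = 0` for all normal `V`. This is `isTotallyGeodesicMap_iff`, valid for every
Riemannian map.

The bi-slant Kenmotsu structure only rewrites the last condition. For `W = F_* Y`, the Kenmotsu
formula carries `∇^F` past `ψ` up to terms that pair to zero, so `⟪∇W, V⟫ = ⟪∇(ψW), ψV⟫ = ⟪∇(PW),
ψV⟫ + ⟪∇(QW), ψV⟫` and `⟪∇(PW), ψV⟫ = -⟪∇(P²W), V⟫ - ⟪∇(QPW), V⟫`. Slantness gives `P² = -cos² θ₁ σ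
- cos² θ₂ τ` with `τW = W - σW - η(W)ξ`, and `ξ` contributes nothing normal. The result,
`IsBiSlant.inner_pullbackCov`, says that the two sides of condition 1 differ by exactly `⟪∇W, V⟫`.

The calculus along `F` rests on `eq_of_tensorial_along`: defects of the expected identities are
tensorial, so they can be tested on fields with constant coordinates. -/

/-! ### Linear algebra of slant subspaces -/

section LinearAlgebra

variable {H : Type*} [NormedAddCommGroup H] [InnerProductSpace ℝ H]

open Submodule

theorem inner_starProjection_comm [FiniteDimensional ℝ H] (D : Submodule ℝ H) (u v : H) :
    inner ℝ (D.starProjection u) v = inner ℝ u (D.starProjection v) :=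
  D.inner_starProjection_left_eq_right u v

theorem inner_starProjection_of_mem_right [FiniteDimensional ℝ H] (D : Submodule ℝ H) (u : H)
    {v : H} (hv : v ∈ D) :
    inner ℝ (D.starProjection u) v = inner ℝ u v := by
  rw [inner_starProjection_comm, D.starProjection_eq_self_iff.2 hv]

/-- If a symmetric operator has vanishing quadratic form on a subspace that it preserves, then it
vanishes there. -/
theorem eq_zero_of_quadraticForm_eq_zero (D : Submodule ℝ H) (S : H →L[ℝ] H)
    (hS : ∀ w ∈ D, S w ∈ D)
    (hsymm : ∀ w ∈ D, ∀ v ∈ D, inner ℝ (S w) v = inner ℝ w (S v))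
    (hq : ∀ w ∈ D, inner ℝ (S w) w = 0) {w : H} (hw : w ∈ D) : S w = 0 := by
  -- Polarization: by symmetry, the form at `w + S w` is `q(w) + q(S w) + 2‖S w‖²`.
  have h1 := hq _ (D.add_mem hw (hS w hw))
  have h2 := hq _ hw
  have h3 := hq _ (hS w hw)
  have h4 := hsymm _ (hS w hw) _ hw
  simp only [map_add, inner_add_left, inner_add_right] at h1
  have h5 : inner ℝ (S w) (S w) = 0 := by linarith
  exact inner_self_eq_zero.1 h5

/-- The square of the tangential part of a skew isometry on a slant subspace. -/
theorem starProjection_comp_sq_of_slant [FiniteDimensional ℝ H] (D : Submodule ℝ H)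
    (ψ : H →L[ℝ] H) (θ : ℝ)
    (hskew : ∀ u v, inner ℝ (ψ u) v = -inner ℝ u (ψ v))
    (hiso : ∀ w ∈ D, inner ℝ (ψ w) (ψ w) = inner ℝ w w)
    (hθ : ∀ w ∈ D, w ≠ 0 → InnerProductGeometry.angle (ψ w) (D.starProjection (ψ w)) = θ)
    {w : H} (hw : w ∈ D) :
    D.starProjection (ψ (D.starProjection (ψ w))) = -(Real.cos θ ^ 2 • w) := by
  set T : H →L[ℝ] H := D.starProjection ∘L ψ with hT
  have hTD : ∀ w, T w ∈ D := fun w => D.starProjection_apply_mem _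
  have hTskew : ∀ w ∈ D, ∀ v ∈ D, inner ℝ (T w) v = -inner ℝ w (T v) := by
    intro w hw v hv
    simp only [hT, ContinuousLinearMap.comp_apply]
    rw [inner_starProjection_of_mem_right D _ hv, hskew, ← inner_starProjection_comm,
      D.starProjection_eq_self_iff.2 hw]
  have hnorm : ∀ w ∈ D, inner ℝ (T w) (T w) = Real.cos θ ^ 2 * inner ℝ w w := by
    intro w hw
    by_cases hw0 : w = 0
    · simp [hw0]
    have h1 := hiso w hw
    have h2 : inner ℝ (ψ w) (T w) = inner ℝ (T w) (T w) := by
      simp only [hT, ContinuousLinearMap.comp_apply]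
      rw [inner_starProjection_of_mem_right D _ (D.starProjection_apply_mem _)]
    have h3 := InnerProductGeometry.cos_angle_mul_norm_mul_norm (ψ w) (T w)
    have h4 : InnerProductGeometry.angle (ψ w) (T w) = θ := hθ w hw hw0
    rw [h4, h2, real_inner_self_eq_norm_sq] at h3
    rw [real_inner_self_eq_norm_sq, real_inner_self_eq_norm_sq] at h1
    rw [real_inner_self_eq_norm_sq, real_inner_self_eq_norm_sq, ← h1]
    -- The angle with the zero vector is `π / 2` by convention, so `T w = 0` forces `cos θ = 0`;
    -- otherwise `‖T w‖` can be cancelled in `h3`.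
    by_cases hT0 : T w = 0
    · have : Real.cos θ = 0 := by
        rw [← h4, hT0, InnerProductGeometry.angle_zero_right, Real.cos_pi_div_two]
      simp [this, hT0]
    · have h5 : ‖T w‖ = Real.cos θ * ‖ψ w‖ := by
        have : ‖T w‖ ≠ 0 := norm_ne_zero_iff.2 hT0
        apply mul_right_cancel₀ this
        nlinarith
      rw [h5]; ring
  -- `T` is skew on `D`, so `T² + cos² θ` is symmetric there, with quadratic form `-‖T w‖² + cos² θ
  -- ‖w‖² = 0`.
  have key := eq_zero_of_quadraticForm_eq_zero D
    (T ∘L T + Real.cos θ ^ 2 • ContinuousLinearMap.id ℝ H)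
    (fun w hw => by
      simp only [add_apply, ContinuousLinearMap.comp_apply,
        smul_apply, ContinuousLinearMap.id_apply]
      exact D.add_mem (hTD _) (D.smul_mem _ hw))
    (fun w hw v hv => by
      simp only [add_apply, ContinuousLinearMap.comp_apply,
        smul_apply, ContinuousLinearMap.id_apply, inner_add_left,
        inner_add_right, inner_smul_left, inner_smul_right]
      rw [hTskew _ (hTD w) _ hv, hTskew _ hw _ (hTD v)]
      simp)
    (fun w hw => by
      simp only [add_apply, ContinuousLinearMap.comp_apply,
        smul_apply, ContinuousLinearMap.id_apply, inner_add_left,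
        inner_smul_left]
      rw [hTskew _ (hTD w) _ hw, hnorm w hw]
      simp)
    hw
  simp only [add_apply, ContinuousLinearMap.comp_apply,
    smul_apply, ContinuousLinearMap.id_apply, hT] at key
  exact eq_neg_of_add_eq_zero_left key

variable [FiniteDimensional ℝ H] {R D₁ D₂ : Submodule ℝ H} {ξ : H}

/-- Orthogonal projection onto an orthogonal sum `D₁ ⊕ D₂ ⊕ ⟨ξ⟩`. -/
theorem starProjection_eq_add_add (hR : R = D₁ ⊔ D₂ ⊔ span ℝ {ξ}) (h₁₂ : D₁ ⟂ D₂)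
    (h₁ : D₁ ⟂ span ℝ {ξ}) (h₂ : D₂ ⟂ span ℝ {ξ}) (hξ : inner ℝ ξ ξ = (1 : ℝ)) (u : H) :
    R.starProjection u
      = D₁.starProjection u + D₂.starProjection u + (inner ℝ u ξ : ℝ) • ξ := by
  have m₁ := D₁.starProjection_apply_mem u
  have m₂ := D₂.starProjection_apply_mem u
  have mξ := mem_span_singleton_self (R := ℝ) ξ
  refine eq_starProjection_of_mem_of_inner_eq_zero ?_ ?_
  · rw [hR]
    exact add_mem (mem_sup_left (add_mem (mem_sup_left m₁) (mem_sup_right m₂)))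
      (mem_sup_right (smul_mem _ _ mξ))
  · intro w hw
    rw [hR] at hw
    obtain ⟨a, ha, b, hb, rfl⟩ := mem_sup.1 hw
    obtain ⟨a₁, ha₁, a₂, ha₂, rfl⟩ := mem_sup.1 ha
    obtain ⟨c, rfl⟩ := mem_span_singleton.1 hb
    simp only [inner_sub_left, inner_add_left, inner_add_right, inner_smul_right, inner_smul_left,
      hξ, inner_starProjection_of_mem_right D₁ u ha₁, inner_starProjection_of_mem_right D₂ u ha₂,
      h₁₂.inner_eq m₁ ha₂, h₁₂.symm.inner_eq m₂ ha₁, h₁.inner_eq m₁ mξ, h₂.inner_eq m₂ mξ,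
      h₁.symm.inner_eq mξ ha₁, h₂.symm.inner_eq mξ ha₂]
    simp

/-- The square of the tangential part of `ψ` on a bi-slant subspace `R = D₁ ⊕ D₂ ⊕ ⟨ξ⟩`. -/
theorem starProjection_comp_sq_of_biSlant (hR : R = D₁ ⊔ D₂ ⊔ span ℝ {ξ}) (h₁₂ : D₁ ⟂ D₂)
    (h₁ : D₁ ⟂ span ℝ {ξ}) (h₂ : D₂ ⟂ span ℝ {ξ}) (hξ : inner ℝ ξ ξ = (1 : ℝ))
    (ψ : H →L[ℝ] H) (hψξ : ψ ξ = 0) (θ₁ θ₂ : ℝ)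
    (hskew : ∀ u v, inner ℝ (ψ u) v = -inner ℝ u (ψ v))
    (hiso : ∀ w, inner ℝ w ξ = (0 : ℝ) → inner ℝ (ψ w) (ψ w) = inner ℝ w w)
    (hθ₁ : ∀ w ∈ D₁, w ≠ 0 → InnerProductGeometry.angle (ψ w) (D₁.starProjection (ψ w)) = θ₁)
    (hθ₂ : ∀ w ∈ D₂, w ≠ 0 → InnerProductGeometry.angle (ψ w) (D₂.starProjection (ψ w)) = θ₂)
    (hψ₁ : ∀ v ∈ D₁, ∀ w ∈ D₂, inner ℝ (ψ v) w = (0 : ℝ))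
    (hψ₂ : ∀ v ∈ D₂, ∀ w ∈ D₁, inner ℝ (ψ v) w = (0 : ℝ)) {w : H} (hw : w ∈ R) :
    R.starProjection (ψ (R.starProjection (ψ w)))
      = -(Real.cos θ₁ ^ 2 • D₁.starProjection w)
        - Real.cos θ₂ ^ 2 • (w - D₁.starProjection w - (inner ℝ w ξ : ℝ) • ξ) := by
  have mξ := mem_span_singleton_self (R := ℝ) ξ
  have hdec := starProjection_eq_add_add hR h₁₂ h₁ h₂ hξ
  have hψη : ∀ u, inner ℝ (ψ u) ξ = (0 : ℝ) := fun u => by rw [hskew, hψξ]; simp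
  have z₁ : ∀ v ∈ D₁, D₂.starProjection (ψ v) = 0 := fun v hv =>
    (D₂.starProjection_apply_eq_zero_iff).2 ((D₂.mem_orthogonal' _).2 fun x hx => hψ₁ v hv x hx)
  have z₂ : ∀ v ∈ D₂, D₁.starProjection (ψ v) = 0 := fun v hv =>
    (D₁.starProjection_apply_eq_zero_iff).2 ((D₁.mem_orthogonal' _).2 fun x hx => hψ₂ v hv x hx)
  -- On each `Dᵢ` the projection to `R` may be replaced by that to `Dᵢ`, so the square is computed
  -- separately on the two slant summands.
  have t₁ : ∀ v ∈ D₁, R.starProjection (ψ v) = D₁.starProjection (ψ v) := fun v hv => by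
    rw [hdec, z₁ v hv, hψη]; simp
  have t₂ : ∀ v ∈ D₂, R.starProjection (ψ v) = D₂.starProjection (ψ v) := fun v hv => by
    rw [hdec, z₂ v hv, hψη]; simp
  have hw' : w = D₁.starProjection w + D₂.starProjection w + (inner ℝ w ξ : ℝ) • ξ := by
    rw [← hdec, R.starProjection_eq_self_iff.2 hw]
  have m₁ := D₁.starProjection_apply_mem w
  have m₂ := D₂.starProjection_apply_mem w
  have s₁ := starProjection_comp_sq_of_slant D₁ ψ θ₁ hskew
    (fun v hv => hiso v (h₁.inner_eq hv mξ)) hθ₁ m₁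
  have s₂ := starProjection_comp_sq_of_slant D₂ ψ θ₂ hskew
    (fun v hv => hiso v (h₂.inner_eq hv mξ)) hθ₂ m₂
  have e : R.starProjection (ψ w) = D₁.starProjection (ψ (D₁.starProjection w))
      + D₂.starProjection (ψ (D₂.starProjection w)) := by
    conv_lhs => rw [hw']
    simp only [map_add, map_smul, hψξ, smul_zero, add_zero]
    rw [t₁ _ m₁, t₂ _ m₂]
  have hτ : w - D₁.starProjection w - (inner ℝ w ξ : ℝ) • ξ = D₂.starProjection w := by
    nth_rewrite 1 [hw']; abel
  rw [e, map_add, map_add, t₁ _ (D₁.starProjection_apply_mem _),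
    t₂ _ (D₂.starProjection_apply_mem _), s₁, s₂, hτ, sub_eq_add_neg]

end LinearAlgebra

/-! ### Vector fields along a map and tensoriality -/

noncomputable section

namespace BiSlant

variable {E₁ : Type*} [NormedAddCommGroup E₁] [NormedSpace ℝ E₁]
  {N : Type*} [TopologicalSpace N] [ChartedSpace E₁ N]
  {E₂ : Type*} [NormedAddCommGroup E₂] [NormedSpace ℝ E₂] 
  {M : Type*} [TopologicalSpace M] [ChartedSpace E₂ M] [IsManifold 𝓘(ℝ, E₂) ∞ M]

/-- The vector field `V` along `F` is differentiable at `p`. -/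
def MDiffAlongAt (F : N → M) (V : Π p : N, TangentSpace 𝓘(ℝ, E₂) (F p)) (p : N) : Prop :=
  MDifferentiableAt 𝓘(ℝ, E₁) (𝓘(ℝ, E₂).prod 𝓘(ℝ, E₂))
    (fun q => TotalSpace.mk' E₂ (E := fun x : M => TangentSpace 𝓘(ℝ, E₂) x) (F q) (V q)) p

/-- The vector field `V` along `F` is smooth at `p`. -/
def SmoothAlongAt (F : N → M) (V : Π p : N, TangentSpace 𝓘(ℝ, E₂) (F p)) (p : N) : Prop :=
  ContMDiffAt 𝓘(ℝ, E₁) (𝓘(ℝ, E₂).prod 𝓘(ℝ, E₂)) ∞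
    (fun q => TotalSpace.mk' E₂ (E := fun x : M => TangentSpace 𝓘(ℝ, E₂) x) (F q) (V q)) p

/-- The pullback bundle `F^* TM`. -/
abbrev PullbackTangent (F : C^∞⟮𝓘(ℝ, E₁), N; 𝓘(ℝ, E₂), M⟯) : N → Type _ :=
  F *ᵖ (fun x : M => TangentSpace 𝓘(ℝ, E₂) x)

instance (F : C^∞⟮𝓘(ℝ, E₁), N; 𝓘(ℝ, E₂), M⟯) (p : N) : AddCommGroup (PullbackTangent F p) :=
  inferInstanceAs (AddCommGroup (TangentSpace 𝓘(ℝ, E₂) (F p)))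

/-- The fibre coordinate is the same in both total spaces, and the base coordinate (`F` or the
identity) is smooth anyway. This opens the section calculus of vector bundles to fields along `F`.
-/
theorem mdiffAlongAt_iff (F : C^∞⟮𝓘(ℝ, E₁), N; 𝓘(ℝ, E₂), M⟯)
    (V : Π p : N, TangentSpace 𝓘(ℝ, E₂) (F p)) (p : N) :
    MDiffAlongAt (E₁ := E₁) F V p ↔ MDifferentiableAt 𝓘(ℝ, E₁) (𝓘(ℝ, E₁).prod 𝓘(ℝ, E₂))
      (fun q => TotalSpace.mk' E₂ (E := PullbackTangent F) q (V q)) p := by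
  unfold MDiffAlongAt
  rw [mdifferentiableAt_totalSpace, mdifferentiableAt_totalSpace]
  have h1 : MDifferentiableAt 𝓘(ℝ, E₁) 𝓘(ℝ, E₂) (fun q => F q) p :=
    F.contMDiff.mdifferentiableAt (by simp)
  have h2 : MDifferentiableAt 𝓘(ℝ, E₁) 𝓘(ℝ, E₁) (fun q : N => q) p := mdifferentiableAt_id
  constructor
  · rintro ⟨-, h⟩
    exact ⟨h2, h⟩
  · rintro ⟨-, h⟩
    exact ⟨h1, h⟩

theorem smoothAlongAt_iff (F : C^∞⟮𝓘(ℝ, E₁), N; 𝓘(ℝ, E₂), M⟯)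
    (V : Π p : N, TangentSpace 𝓘(ℝ, E₂) (F p)) (p : N) :
    SmoothAlongAt (E₁ := E₁) F V p ↔ ContMDiffAt 𝓘(ℝ, E₁) (𝓘(ℝ, E₁).prod 𝓘(ℝ, E₂)) ∞
      (fun q => TotalSpace.mk' E₂ (E := PullbackTangent F) q (V q)) p := by
  unfold SmoothAlongAt
  rw [contMDiffAt_totalSpace, contMDiffAt_totalSpace]
  have h1 : ContMDiffAt 𝓘(ℝ, E₁) 𝓘(ℝ, E₂) ∞ (fun q => F q) p := F.contMDiff.contMDiffAt
  have h2 : ContMDiffAt 𝓘(ℝ, E₁) 𝓘(ℝ, E₁) ∞ (fun q : N => q) p := contMDiffAt_id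
  constructor
  · rintro ⟨-, h⟩
    exact ⟨h2, h⟩
  · rintro ⟨-, h⟩
    exact ⟨h1, h⟩

theorem SmoothAlongAt.mdiffAlongAt {F : N → M}
    {V : Π p : N, TangentSpace 𝓘(ℝ, E₂) (F p)} {p : N} (h : SmoothAlongAt (E₁ := E₁) F V p) :
    MDiffAlongAt (E₁ := E₁) F V p :=
  ContMDiffAt.mdifferentiableAt h (by simp)

variable {F : N → M} {V W : Π p : N, TangentSpace 𝓘(ℝ, E₂) (F p)} {p : N}

omit [IsManifold 𝓘(ℝ, E₂) ∞ M] in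
-- Moves a statement about a bare `F` to the pullback bundle, which is formed along a bundled map.
theorem exists_contMDiffMap (hF : ContMDiff 𝓘(ℝ, E₁) 𝓘(ℝ, E₂) ∞ F) :
    ∃ G : C^∞⟮𝓘(ℝ, E₁), N; 𝓘(ℝ, E₂), M⟯, ⇑G = F := ⟨⟨F, hF⟩, rfl⟩

theorem SmoothAlongAt.smul (hF : ContMDiff 𝓘(ℝ, E₁) 𝓘(ℝ, E₂) ∞ F) {f : N → ℝ}
    (hf : ContMDiffAt 𝓘(ℝ, E₁) 𝓘(ℝ, ℝ) ∞ f p) (hV : SmoothAlongAt (E₁ := E₁) F V p) :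
    SmoothAlongAt (E₁ := E₁) F (fun q => f q • V q) p := by
  obtain ⟨G, rfl⟩ := exists_contMDiffMap hF
  rw [smoothAlongAt_iff] at hV ⊢
  exact hf.smul_section hV

theorem SmoothAlongAt.add (hF : ContMDiff 𝓘(ℝ, E₁) 𝓘(ℝ, E₂) ∞ F)
    (hV : SmoothAlongAt (E₁ := E₁) F V p) (hW : SmoothAlongAt (E₁ := E₁) F W p) :
    SmoothAlongAt (E₁ := E₁) F (fun q => V q + W q) p := by
  obtain ⟨G, rfl⟩ := exists_contMDiffMap hF
  rw [smoothAlongAt_iff] at hV hW ⊢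
  exact hV.add_section hW

theorem SmoothAlongAt.sum (hF : ContMDiff 𝓘(ℝ, E₁) 𝓘(ℝ, E₂) ∞ F) {ι : Type*} {s : Finset ι}
    {V : ι → Π p : N, TangentSpace 𝓘(ℝ, E₂) (F p)}
    (hV : ∀ i ∈ s, SmoothAlongAt (E₁ := E₁) F (V i) p) :
    SmoothAlongAt (E₁ := E₁) F (fun q => ∑ i ∈ s, V i q) p := by
  obtain ⟨G, rfl⟩ := exists_contMDiffMap hF
  simp only [smoothAlongAt_iff] at hV ⊢
  exact ContMDiffAt.sum_section hV

/-- An operation on vector fields along `F` that is additive and linear over functions depends only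
on the value of the vector field at the point. -/
theorem eq_of_tensorial_along [FiniteDimensional ℝ E₂] {A : Type*} [AddCommGroup A] [Module ℝ A]
    (hF : ContMDiff 𝓘(ℝ, E₁) 𝓘(ℝ, E₂) ∞ F)
    (Φ : (Π p : N, TangentSpace 𝓘(ℝ, E₂) (F p)) → A)
    (hsmul : ∀ (f : N → ℝ) (V : Π p : N, TangentSpace 𝓘(ℝ, E₂) (F p)),
      MDifferentiableAt 𝓘(ℝ, E₁) 𝓘(ℝ, ℝ) f p → MDiffAlongAt (E₁ := E₁) F V p →
      Φ (fun q => f q • V q) = f p • Φ V)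
    (hadd : ∀ (V W : Π p : N, TangentSpace 𝓘(ℝ, E₂) (F p)), MDiffAlongAt (E₁ := E₁) F V p →
      MDiffAlongAt (E₁ := E₁) F W p → Φ (fun q => V q + W q) = Φ V + Φ W)
    (hV : MDiffAlongAt (E₁ := E₁) F V p) (hW : MDiffAlongAt (E₁ := E₁) F W p) (h : V p = W p) :
    Φ V = Φ W := by
  obtain ⟨G, rfl⟩ := exists_contMDiffMap hF
  simp only [mdiffAlongAt_iff] at hV hW hsmul hadd
  have hT : TensorialAt 𝓘(ℝ, E₁) (V := PullbackTangent G) E₂ Φ p :=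
    { smul := fun hf hσ => hsmul _ _ hf hσ
      add := fun hσ hσ' => hadd _ _ hσ hσ' }
  have : ContMDiffVectorBundle 1 E₂ (PullbackTangent G) 𝓘(ℝ, E₁) :=
    ContMDiffVectorBundle.of_le (n := ∞) (ENat.LEInfty.out)
  exact hT.pointwise hV hW h

end BiSlant
end

/-! ### The pullback connection in coordinates -/

noncomputable section

namespace BiSlant

section Extend

variable {E : Type*} [NormedAddCommGroup E] [NormedSpace ℝ E]
  {M : Type*} [TopologicalSpace M] [ChartedSpace E M] [IsManifold 𝓘(ℝ, E) ∞ M]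

theorem eventually_mem_baseSet_trivializationAt (x : M) :
    ∀ᶠ y in 𝓝 x,
      y ∈ (trivializationAt E (fun y : M => TangentSpace 𝓘(ℝ, E) y) x).baseSet :=
  (trivializationAt E (fun y : M => TangentSpace 𝓘(ℝ, E) y) x).open_baseSet.mem_nhds
    (FiberBundle.mem_baseSet_trivializationAt' x)

theorem extend_add {x : M} (v w : TangentSpace 𝓘(ℝ, E) x) :
    ∀ᶠ y in 𝓝 x, (FiberBundle.extend E (v + w) y : TangentSpace 𝓘(ℝ, E) y)
      = (FiberBundle.extend E v + FiberBundle.extend E w : Π y : M, TangentSpace 𝓘(ℝ, E) y) y := by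
  have h := ((trivializationAt E (fun y : M => TangentSpace 𝓘(ℝ, E) y) x).linear ℝ
    (FiberBundle.mem_baseSet_trivializationAt' x)).map_add v w
  filter_upwards [eventually_mem_baseSet_trivializationAt (E := E) x] with y hy
  simp only [FiberBundle.extend, Pi.add_apply, h, ← Trivialization.coe_symmₗ (R := ℝ) _ hy, map_add]

theorem extend_smul {x : M} (c : ℝ) (v : TangentSpace 𝓘(ℝ, E) x) :
    ∀ᶠ y in 𝓝 x, (FiberBundle.extend E (c • v) y : TangentSpace 𝓘(ℝ, E) y)
      = (c • FiberBundle.extend E v : Π y : M, TangentSpace 𝓘(ℝ, E) y) y := by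
  have h := ((trivializationAt E (fun y : M => TangentSpace 𝓘(ℝ, E) y) x).linear ℝ
    (FiberBundle.mem_baseSet_trivializationAt' x)).map_smul c v
  filter_upwards [eventually_mem_baseSet_trivializationAt (E := E) x] with y hy
  simp only [FiberBundle.extend, Pi.smul_apply, h, ← Trivialization.coe_symmₗ (R := ℝ) _ hy,
    map_smul]

theorem mdifferentiableAt_extend {x : M} (v : TangentSpace 𝓘(ℝ, E) x) :
    MDifferentiableAt 𝓘(ℝ, E) (𝓘(ℝ, E).prod 𝓘(ℝ, E))
      (fun y => TotalSpace.mk' E y (FiberBundle.extend E v y :  TangentSpace 𝓘(ℝ, E) y)) x :=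
  FiberBundle.mdifferentiableAt_extend ..

variable (cov : CovariantDerivative 𝓘(ℝ, E) E (fun x : M => TangentSpace 𝓘(ℝ, E) x))

/-- Together with `cov_extend_smul`, this is the linearity of the Christoffel term. Agreement of the
fields near `x` suffices because a connection is local. -/
theorem cov_extend_add {x : M} (v w : TangentSpace 𝓘(ℝ, E) x) :
    cov (FiberBundle.extend E (v + w)) x
      = cov (FiberBundle.extend E v) x + cov (FiberBundle.extend E w) x := by
  rw [← cov.isCovariantDerivativeOnUniv.add (mdifferentiableAt_extend v)
    (mdifferentiableAt_extend w)]
  exact cov.isCovariantDerivativeOnUniv.congr_of_eventuallyEq (mdifferentiableAt_extend _)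
    (mdifferentiableAt_add_section (mdifferentiableAt_extend v) (mdifferentiableAt_extend w))
    Filter.univ_mem (extend_add v w)

theorem cov_extend_smul {x : M} (c : ℝ) (v : TangentSpace 𝓘(ℝ, E) x) :
    cov (FiberBundle.extend E (c • v)) x = c • cov (FiberBundle.extend E v) x := by
  rw [← cov.isCovariantDerivativeOnUniv.smul_const c (mdifferentiableAt_extend v)]
  exact cov.isCovariantDerivativeOnUniv.congr_of_eventuallyEq (mdifferentiableAt_extend _)
    (MDifferentiableAt.smul_const_section (mdifferentiableAt_extend v))
    Filter.univ_mem (extend_smul c v)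

end Extend

variable {E₁ : Type*} [NormedAddCommGroup E₁] [NormedSpace ℝ E₁]
  {N : Type*} [TopologicalSpace N] [ChartedSpace E₁ N]
  {E₂ : Type*} [NormedAddCommGroup E₂] [NormedSpace ℝ E₂]
  {M : Type*} [TopologicalSpace M] [ChartedSpace E₂ M] [IsManifold 𝓘(ℝ, E₂) ∞ M]

/-- The coordinate representation near `p` of the vector field `V` along `F`. -/
def coordAlong (F : N → M) (V : Π p : N, TangentSpace 𝓘(ℝ, E₂) (F p)) (p q : N) : E₂ :=
  (trivializationAt E₂ (fun x : M => TangentSpace 𝓘(ℝ, E₂) x) (F p)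
    (TotalSpace.mk' E₂ (F q) (V q))).2

section Coord

variable {F : N → M} {V W : Π p : N, TangentSpace 𝓘(ℝ, E₂) (F p)} {p : N}

theorem MDiffAlongAt.coordAlong (hV : MDiffAlongAt (E₁ := E₁) F V p) :
    MDifferentiableAt 𝓘(ℝ, E₁) 𝓘(ℝ, E₂) (coordAlong F V p) p :=
  ((mdifferentiableAt_totalSpace _ _).1 hV).2

theorem eventually_mem_baseSet (hF : ContMDiff 𝓘(ℝ, E₁) 𝓘(ℝ, E₂) ∞ F) (p : N) :
    ∀ᶠ q in 𝓝 p, F q ∈ (trivializationAt E₂ (fun x : M => TangentSpace 𝓘(ℝ, E₂) x) (F p)).baseSet :=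
  hF.continuous.continuousAt.eventually_mem
    ((trivializationAt E₂ (fun x : M => TangentSpace 𝓘(ℝ, E₂) x) (F p)).open_baseSet.mem_nhds
      (FiberBundle.mem_baseSet_trivializationAt' (F p)))

theorem coordAlong_add (hF : ContMDiff 𝓘(ℝ, E₁) 𝓘(ℝ, E₂) ∞ F) :
    coordAlong F (fun q => V q + W q) p =ᶠ[𝓝 p] coordAlong F V p + coordAlong F W p := by
  filter_upwards [eventually_mem_baseSet hF p] with q hq
  exact ((trivializationAt E₂ (fun y : M => TangentSpace 𝓘(ℝ, E₂) y) (F p)).linear ℝ hq).map_add _ _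

theorem coordAlong_smul (hF : ContMDiff 𝓘(ℝ, E₁) 𝓘(ℝ, E₂) ∞ F) (f : N → ℝ) :
    coordAlong F (fun q => f q • V q) p =ᶠ[𝓝 p] f • coordAlong F V p := by
  filter_upwards [eventually_mem_baseSet hF p] with q hq
  exact ((trivializationAt E₂ (fun y : M => TangentSpace 𝓘(ℝ, E₂) y) (F p)).linear ℝ hq).map_smul _ _

theorem mvfderiv_congr {f g : N → E₂} (h : f =ᶠ[𝓝 p] g) :
    mvfderiv 𝓘(ℝ, E₁) f p = mvfderiv 𝓘(ℝ, E₁) g p := by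
  ext u
  have := h.mfderiv_eq (I := 𝓘(ℝ, E₁)) (I' := 𝓘(ℝ, E₂))
  simp only [mvfderiv]
  exact congrArg (fun L : E₁ →L[ℝ] E₂ => L u) this

omit [TopologicalSpace N] in
theorem symmL_coordAlong :
    (trivializationAt E₂ (fun x : M => TangentSpace 𝓘(ℝ, E₂) x) (F p)).symmL ℝ (F p)
      (coordAlong F V p p) = V p := by
  have h := FiberBundle.mem_baseSet_trivializationAt' (F := E₂)
    (E := fun x : M => TangentSpace 𝓘(ℝ, E₂) x) (F p)
  rw [Trivialization.symmL_apply _ h]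
  exact Trivialization.symm_apply_apply_mk _ h _

variable (cov : CovariantDerivative 𝓘(ℝ, E₂) E₂ (fun x : M => TangentSpace 𝓘(ℝ, E₂) x))

theorem pullbackCov_apply (u : TangentSpace 𝓘(ℝ, E₁) p) :
    pullbackCov cov F V p u
      = (trivializationAt E₂ (fun x : M => TangentSpace 𝓘(ℝ, E₂) x) (F p)).symmL ℝ (F p)
          (mvfderiv 𝓘(ℝ, E₁) (coordAlong F V p) p u)
        + cov (FiberBundle.extend E₂ (V p)) (F p) (differential F p u) := rfl

theorem pullbackCov_add (hF : ContMDiff 𝓘(ℝ, E₁) 𝓘(ℝ, E₂) ∞ F)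
    (hV : MDiffAlongAt (E₁ := E₁) F V p) (hW : MDiffAlongAt (E₁ := E₁) F W p)
    (u : TangentSpace 𝓘(ℝ, E₁) p) :
    pullbackCov cov F (fun q => V q + W q) p u = pullbackCov cov F V p u + pullbackCov cov F W p u := by
  simp only [pullbackCov_apply]
  rw [mvfderiv_congr (coordAlong_add hF), mvfderiv_add hV.coordAlong hW.coordAlong, cov_extend_add]
  simp only [add_apply, map_add]
  abel

/-- The derivative of `f` comes only from the coordinate term; `symmL_coordAlong` turns the
coordinates it multiplies back into `V p`. -/
theorem pullbackCov_smul (hF : ContMDiff 𝓘(ℝ, E₁) 𝓘(ℝ, E₂) ∞ F) {f : N → ℝ}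
    (hf : MDifferentiableAt 𝓘(ℝ, E₁) 𝓘(ℝ, ℝ) f p) (hV : MDiffAlongAt (E₁ := E₁) F V p)
    (u : TangentSpace 𝓘(ℝ, E₁) p) :
    pullbackCov cov F (fun q => f q • V q) p u
      = f p • pullbackCov cov F V p u + mvfderiv 𝓘(ℝ, E₁) f p u • V p := by
  simp only [pullbackCov_apply]
  rw [mvfderiv_congr (coordAlong_smul hF f), mvfderiv_smul hf hV.coordAlong, cov_extend_smul]
  simp only [add_apply, smul_apply, map_add, map_smul, ContinuousLinearMap.smulRight_apply,
    symmL_coordAlong]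
  module

end Coord

section Comp

variable [FiniteDimensional ℝ E₂]
  (cov : CovariantDerivative 𝓘(ℝ, E₂) E₂ (fun x : M => TangentSpace 𝓘(ℝ, E₂) x))

/-- A connection in the coordinates of the preferred trivialization. -/
theorem cov_eq_pullbackCov_id {Y : Π x : M, TangentSpace 𝓘(ℝ, E₂) x} {x : M}
    (hY : MDifferentiableAt 𝓘(ℝ, E₂) (𝓘(ℝ, E₂).prod 𝓘(ℝ, E₂)) (fun x => TotalSpace.mk' E₂ x (Y x)) x)
    (u : TangentSpace 𝓘(ℝ, E₂) x) :
    cov Y x u = (trivializationAt E₂ (fun x : M => TangentSpace 𝓘(ℝ, E₂) x) x).symmL ℝ x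
          (mvfderiv 𝓘(ℝ, E₂) (coordAlong (fun x : M => x) Y x) x u)
        + cov (FiberBundle.extend E₂ (Y x)) x u := by
  have hid : ContMDiff 𝓘(ℝ, E₂) 𝓘(ℝ, E₂) ∞ (fun x : M => x) := contMDiff_id
  set e := trivializationAt E₂ (fun x : M => TangentSpace 𝓘(ℝ, E₂) x) x
  -- Connection minus coordinate derivative is tensorial, since the terms in `df` cancel. So `Y` may
  -- be replaced by the extension of `Y x` with constant coordinates, whose coordinate derivative is
  -- zero.
  let Φ : (Π x : M, TangentSpace 𝓘(ℝ, E₂) x) → TangentSpace 𝓘(ℝ, E₂) x := fun Y =>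
    cov Y x u - e.symmL ℝ x (mvfderiv 𝓘(ℝ, E₂) (coordAlong (fun x : M => x) Y x) x u)
  have key : Φ Y = Φ (FiberBundle.extend E₂ (Y x)) := by
    refine eq_of_tensorial_along (F := fun x : M => x) hid Φ ?_ ?_ hY (mdifferentiableAt_extend _)
      (by simp)
    · intro f V hf hV
      have h1 : cov (fun q => f q • V q) x = _ := cov.isCovariantDerivativeOnUniv.leibniz hV hf
      have h2 := symmL_coordAlong (F := fun x : M => x) (V := V) (p := x)
      simp only [Φ, h1]
      rw [mvfderiv_congr (coordAlong_smul hid f), mvfderiv_smul hf (MDiffAlongAt.coordAlong hV)]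
      simp only [add_apply, smul_apply, map_add, map_smul, ContinuousLinearMap.smulRight_apply]
      erw [h2]
      module
    · intro V W hV hW
      have h1 : cov (fun q => V q + W q) x = _ := cov.isCovariantDerivativeOnUniv.add hV hW
      simp only [Φ, h1]
      rw [mvfderiv_congr (coordAlong_add hid), mvfderiv_add (MDiffAlongAt.coordAlong hV)
        (MDiffAlongAt.coordAlong hW)]
      simp only [add_apply, map_add]
      module
  have hconst : coordAlong (fun x : M => x) (FiberBundle.extend E₂ (Y x)) x =ᶠ[𝓝 x]
      fun _ => (e (TotalSpace.mk' E₂ x (Y x))).2 := by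
    filter_upwards [eventually_mem_baseSet hid x] with y hy
    have h := Trivialization.apply_mk_symm e hy (e (TotalSpace.mk' E₂ x (Y x))).2
    exact (Prod.ext_iff.1 h).2
  have h0 : mvfderiv 𝓘(ℝ, E₂) (coordAlong (fun x : M => x) (FiberBundle.extend E₂ (Y x)) x) x u
      = 0 := by
    rw [mvfderiv_congr hconst, mvfderiv_const]; rfl
  simp only [Φ, h0, map_zero, sub_zero] at key
  rw [← key]; abel

variable {F : N → M} {p : N}

omit [FiniteDimensional ℝ E₂] in
theorem mdiffAlongAt_comp (hF : ContMDiff 𝓘(ℝ, E₁) 𝓘(ℝ, E₂) ∞ F)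
    {Y : Π x : M, TangentSpace 𝓘(ℝ, E₂) x}
    (hY : MDifferentiableAt 𝓘(ℝ, E₂) (𝓘(ℝ, E₂).prod 𝓘(ℝ, E₂))
      (fun x => TotalSpace.mk' E₂ x (Y x)) (F p)) :
    MDiffAlongAt (E₁ := E₁) F (fun q => Y (F q)) p :=
  MDifferentiableAt.comp p hY (hF.mdifferentiableAt (by simp))

/-- `∇^F (Y ∘ F) = (∇ Y) ∘ F_*` -/
theorem pullbackCov_comp (hF : ContMDiff 𝓘(ℝ, E₁) 𝓘(ℝ, E₂) ∞ F)
    {Y : Π x : M, TangentSpace 𝓘(ℝ, E₂) x}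
    (hY : MDifferentiableAt 𝓘(ℝ, E₂) (𝓘(ℝ, E₂).prod 𝓘(ℝ, E₂))
      (fun x => TotalSpace.mk' E₂ x (Y x)) (F p)) (u : TangentSpace 𝓘(ℝ, E₁) p) :
    pullbackCov cov F (fun q => Y (F q)) p u = cov Y (F p) (differential F p u) := by
  -- The Christoffel terms now agree; the coordinate terms agree by the chain rule.
  rw [pullbackCov_apply, cov_eq_pullbackCov_id cov hY]
  congr 2
  exact mfderiv_comp_apply p (MDiffAlongAt.coordAlong (F := fun x : M => x) hY)
    (hF.mdifferentiableAt (by simp)) u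

end Comp

end BiSlant
end

/-! ### Metric and contact structure along a map; vanishing brackets of coordinate fields -/

noncomputable section

namespace BiSlant

section Rules

variable {E₁ : Type*} [NormedAddCommGroup E₁] [NormedSpace ℝ E₁]
  {N : Type*} [TopologicalSpace N] [ChartedSpace E₁ N]
  {E₂ : Type*} [NormedAddCommGroup E₂] [NormedSpace ℝ E₂]
  {M : Type*} [TopologicalSpace M] [ChartedSpace E₂ M] [IsManifold 𝓘(ℝ, E₂) ∞ M]
  [RiemannianBundle (fun x : M => TangentSpace 𝓘(ℝ, E₂) x)]
  {F : N → M} {V W : Π p : N, TangentSpace 𝓘(ℝ, E₂) (F p)} {p : N}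

variable [IsContMDiffRiemannianBundle 𝓘(ℝ, E₂) ∞ E₂ (fun x : M => TangentSpace 𝓘(ℝ, E₂) x)] in
theorem MDiffAlongAt.inner (hV : MDiffAlongAt (E₁ := E₁) F V p)
    (hW : MDiffAlongAt (E₁ := E₁) F W p) :
    MDifferentiableAt 𝓘(ℝ, E₁) 𝓘(ℝ, ℝ) (fun q => (inner ℝ (V q) (W q) : ℝ)) p := by
  have : IsContMDiffRiemannianBundle 𝓘(ℝ, E₂) 1 E₂ (fun x : M => TangentSpace 𝓘(ℝ, E₂) x) :=
    IsContMDiffRiemannianBundle.of_le (n := ∞) ENat.LEInfty.out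
  exact MDifferentiableAt.inner_bundle hV hW

variable [IsContMDiffRiemannianBundle 𝓘(ℝ, E₂) ∞ E₂ (fun x : M => TangentSpace 𝓘(ℝ, E₂) x)] in
theorem SmoothAlongAt.inner (hV : SmoothAlongAt (E₁ := E₁) F V p)
    (hW : SmoothAlongAt (E₁ := E₁) F W p) :
    ContMDiffAt 𝓘(ℝ, E₁) 𝓘(ℝ, ℝ) ∞ (fun q => (inner ℝ (V q) (W q) : ℝ)) p :=
  ContMDiffAt.inner_bundle hV hW

variable {ψ : Π x : M, TangentSpace 𝓘(ℝ, E₂) x →L[ℝ] TangentSpace 𝓘(ℝ, E₂) x}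
  {ξ : Π x : M, TangentSpace 𝓘(ℝ, E₂) x} {η : Π x : M, TangentSpace 𝓘(ℝ, E₂) x →L[ℝ] ℝ}

theorem SmoothAlongAt.contactTensor (hM : IsAlmostContactMetric ψ ξ η)
    (hF : ContMDiff 𝓘(ℝ, E₁) 𝓘(ℝ, E₂) ∞ F) (hV : SmoothAlongAt (E₁ := E₁) F V p) :
    SmoothAlongAt (E₁ := E₁) F (fun q => ψ (F q) (V q)) p :=
  ContMDiffAt.clm_bundle_apply (ϕ := fun q => ψ (F q))
    (ContMDiffAt.comp p hM.smooth_ψ.contMDiffAt hF.contMDiffAt) hV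

theorem MDiffAlongAt.contactTensor (hM : IsAlmostContactMetric ψ ξ η)
    (hF : ContMDiff 𝓘(ℝ, E₁) 𝓘(ℝ, E₂) ∞ F) (hV : MDiffAlongAt (E₁ := E₁) F V p) :
    MDiffAlongAt (E₁ := E₁) F (fun q => ψ (F q) (V q)) p :=
  MDifferentiableAt.clm_bundle_apply (ϕ := fun q => ψ (F q))
    (MDifferentiableAt.comp p (hM.smooth_ψ.mdifferentiableAt (by simp))
      (hF.mdifferentiableAt (by simp))) hV

variable [FiniteDimensional ℝ E₂]
  [IsContMDiffRiemannianBundle 𝓘(ℝ, E₂) ∞ E₂ (fun x : M => TangentSpace 𝓘(ℝ, E₂) x)]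
  {cov : CovariantDerivative 𝓘(ℝ, E₂) E₂ (fun x : M => TangentSpace 𝓘(ℝ, E₂) x)}

/-- The pullback connection is compatible with the metric. -/
theorem pullbackCov_metric (hcov : IsLeviCivita cov) (hF : ContMDiff 𝓘(ℝ, E₁) 𝓘(ℝ, E₂) ∞ F)
    (hV : MDiffAlongAt (E₁ := E₁) F V p) (hW : MDiffAlongAt (E₁ := E₁) F W p)
    (u : TangentSpace 𝓘(ℝ, E₁) p) :
    mvfderiv 𝓘(ℝ, E₁) (fun q => (inner ℝ (V q) (W q) : ℝ)) p u
      = inner ℝ (pullbackCov cov F V p u) (W p) + inner ℝ (V p) (pullbackCov cov F W p u) := by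
  -- The defect of metric compatibility is tensorial in each argument, so it suffices to treat
  -- fields of the form `Y ∘ F`, where it is compatibility on `M` and the chain rule.
  let Φ : (Π p : N, TangentSpace 𝓘(ℝ, E₂) (F p)) → (Π p : N, TangentSpace 𝓘(ℝ, E₂) (F p)) → ℝ :=
    fun V W => mvfderiv 𝓘(ℝ, E₁) (fun q => (inner ℝ (V q) (W q) : ℝ)) p u
      - inner ℝ (pullbackCov cov F V p u) (W p) - inner ℝ (V p) (pullbackCov cov F W p u)
  have hsymm : ∀ V W, Φ V W = Φ W V := by
    intro V W
    simp only [Φ, real_inner_comm]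
    ring
  have hleft : ∀ {V V' W : Π p : N, TangentSpace 𝓘(ℝ, E₂) (F p)}, MDiffAlongAt (E₁ := E₁) F V p →
      MDiffAlongAt (E₁ := E₁) F V' p → MDiffAlongAt (E₁ := E₁) F W p → V p = V' p →
      Φ V W = Φ V' W := by
    intro V V' W hV hV' hW h
    refine eq_of_tensorial_along hF (fun V => Φ V W) ?_ ?_ hV hV' h
    · intro f V hf hV
      have h1 : mvfderiv 𝓘(ℝ, E₁) (fun q => (inner ℝ (f q • V q) (W q) : ℝ)) p = _ :=
        (congrArg (fun g => mvfderiv 𝓘(ℝ, E₁) g p)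
          (funext fun q => real_inner_smul_left (V q) (W q) (f q))).trans
            (mvfderiv_mul hf (hV.inner hW))
      simp only [Φ]
      rw [h1]
      simp only [pullbackCov_smul cov hF hf hV, inner_add_left, real_inner_smul_left,
        add_apply, smul_apply, smul_eq_mul]
      ring
    · intro V V' hV hV'
      have h1 : mvfderiv 𝓘(ℝ, E₁) (fun q => (inner ℝ (V q + V' q) (W q) : ℝ)) p = _ :=
        (congrArg (fun g => mvfderiv 𝓘(ℝ, E₁) g p)
          (funext fun q => inner_add_left (V q) (V' q) (W q))).trans
            (mvfderiv_add (hV.inner hW) (hV'.inner hW))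
      simp only [Φ]
      rw [h1]
      simp only [pullbackCov_add cov hF hV hV', inner_add_left, add_apply]
      ring
  have hext : ∀ v : TangentSpace 𝓘(ℝ, E₂) (F p),
      MDiffAlongAt (E₁ := E₁) F (fun q => FiberBundle.extend E₂ v (F q)) p :=
    fun v => mdiffAlongAt_comp hF (mdifferentiableAt_extend v)
  have key : Φ V W = Φ (fun q => FiberBundle.extend E₂ (V p) (F q))
      (fun q => FiberBundle.extend E₂ (W p) (F q)) := by
    rw [hleft hV (hext (V p)) hW (by simp), hsymm, hleft hW (hext (W p)) (hext (V p)) (by simp),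
      hsymm]
  have hzero : Φ (fun q => FiberBundle.extend E₂ (V p) (F q))
      (fun q => FiberBundle.extend E₂ (W p) (F q)) = 0 := by
    have h1 := hcov.metric (F p) (differential F p u) _ _ (mdifferentiableAt_extend (V p))
      (mdifferentiableAt_extend (W p))
    have h2 : mvfderiv 𝓘(ℝ, E₁) (fun q => (inner ℝ
        (FiberBundle.extend E₂ (V p) (F q) : TangentSpace 𝓘(ℝ, E₂) (F q))
        (FiberBundle.extend E₂ (W p) (F q)) : ℝ)) p u = _ :=
      mvfderiv_comp_apply p (MDiffAlongAt.inner (F := fun x : M => x)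
        (mdifferentiableAt_extend (V p)) (mdifferentiableAt_extend (W p)))
        (hF.mdifferentiableAt (by simp)) u
    simp only [Φ, pullbackCov_comp cov hF (mdifferentiableAt_extend _)]
    rw [h2, h1]
    ring
  rw [hzero] at key
  simp only [Φ] at key
  linarith

omit [IsContMDiffRiemannianBundle 𝓘(ℝ, E₂) ∞ E₂ (fun x : M => TangentSpace 𝓘(ℝ, E₂) x)] in
/-- The covariant derivative of `ψ` along a map into a Kenmotsu manifold. -/
theorem pullbackCov_contactTensor (hM : IsKenmotsu cov ψ ξ η)
    (hF : ContMDiff 𝓘(ℝ, E₁) 𝓘(ℝ, E₂) ∞ F)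
    (hV : MDiffAlongAt (E₁ := E₁) F V p) (u : TangentSpace 𝓘(ℝ, E₁) p) :
    pullbackCov cov F (fun q => ψ (F q) (V q)) p u - ψ (F p) (pullbackCov cov F V p u)
      = (inner ℝ (ψ (F p) (differential F p u)) (V p) : ℝ) • ξ (F p)
        - η (F p) (V p) • ψ (F p) (differential F p u) := by
  -- Since `ψ` is fibrewise linear, this commutator is tensorial in `V`; on `Y ∘ F` it is the
  -- Kenmotsu identity on `M`.
  let Φ : (Π p : N, TangentSpace 𝓘(ℝ, E₂) (F p)) → TangentSpace 𝓘(ℝ, E₂) (F p) := fun V =>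
    pullbackCov cov F (fun q => ψ (F q) (V q)) p u - ψ (F p) (pullbackCov cov F V p u)
  have key : Φ V = Φ (fun q => FiberBundle.extend E₂ (V p) (F q)) := by
    refine eq_of_tensorial_along hF Φ ?_ ?_ hV
      (mdiffAlongAt_comp hF (mdifferentiableAt_extend (V p))) (by simp)
    · intro f V hf hV
      simp only [Φ, map_smul, pullbackCov_smul cov hF hf hV,
        pullbackCov_smul cov hF hf (hV.contactTensor hM.toIsAlmostContactMetric hF), map_add]
      module
    · intro V W hV hW
      simp only [Φ, map_add, pullbackCov_add cov hF hV hW,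
        pullbackCov_add cov hF (hV.contactTensor hM.toIsAlmostContactMetric hF)
          (hW.contactTensor hM.toIsAlmostContactMetric hF)]
      abel
  have hψ := MDiffAlongAt.contactTensor (F := fun x : M => x) hM.toIsAlmostContactMetric
    contMDiff_id (mdifferentiableAt_extend (V p))
  have h1 := hM.cov_ψ (F p) (differential F p u) _ (mdifferentiableAt_extend (V p))
  have h2 := pullbackCov_comp (E₁ := E₁) cov hF hψ u
  have h3 := pullbackCov_comp (E₁ := E₁) cov hF (mdifferentiableAt_extend (V p)) u
  simp only [FiberBundle.extend_apply_self] at h1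
  rw [← h1, ← h2, ← h3]
  exact key

end Rules

section Symmetry

variable {E : Type*} [NormedAddCommGroup E] [NormedSpace ℝ E]
  {M : Type*} [TopologicalSpace M] [ChartedSpace E M] [IsManifold 𝓘(ℝ, E) ∞ M]

/-- The vector field `extend v` is constant in the preferred chart. -/
theorem mpullbackWithin_extend {x : M} (v : TangentSpace 𝓘(ℝ, E) x) :
    VectorField.mpullbackWithin 𝓘(ℝ, E) 𝓘(ℝ, E) (extChartAt 𝓘(ℝ, E) x).symm
      (FiberBundle.extend E v) (Set.range 𝓘(ℝ, E)) =ᶠ[𝓝 (extChartAt 𝓘(ℝ, E) x x)]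
      fun _ => (trivializationAt E (fun y : M => TangentSpace 𝓘(ℝ, E) y) x
        (TotalSpace.mk' E x v)).2 := by
  filter_upwards [extChartAt_target_mem_nhds (I := 𝓘(ℝ, E)) x] with y hy
  have hs := (extChartAt 𝓘(ℝ, E) x).map_target hy
  rw [extChartAt_source] at hs
  have hb : (extChartAt 𝓘(ℝ, E) x).symm y
      ∈ (trivializationAt E (fun y : M => TangentSpace 𝓘(ℝ, E) y) x).baseSet := hs
  have h := TangentBundle.symmL_trivializationAt (I := 𝓘(ℝ, E)) hs
  rw [(extChartAt 𝓘(ℝ, E) x).right_inv hy] at h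
  simp only [VectorField.mpullbackWithin]
  rw [FiberBundle.extend, ← Trivialization.symmL_apply (R := ℝ) _ hb, h]
  exact (isInvertible_mfderivWithin_extChartAt_symm hy).inverse_apply_self _

/-- The bracket is computed in the preferred chart, where both fields are constant. -/
theorem mlieBracket_extend {x : M} (v w : TangentSpace 𝓘(ℝ, E) x) :
    VectorField.mlieBracket 𝓘(ℝ, E) (FiberBundle.extend E v) (FiberBundle.extend E w) x = 0 := by
  rw [← VectorField.mlieBracketWithin_univ, VectorField.mlieBracketWithin_apply]
  have h : ∀ s : Set E, VectorField.lieBracketWithin ℝ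
      (VectorField.mpullbackWithin 𝓘(ℝ, E) 𝓘(ℝ, E) (extChartAt 𝓘(ℝ, E) x).symm
        (FiberBundle.extend E v) (Set.range 𝓘(ℝ, E)))
      (VectorField.mpullbackWithin 𝓘(ℝ, E) 𝓘(ℝ, E) (extChartAt 𝓘(ℝ, E) x).symm
        (FiberBundle.extend E w) (Set.range 𝓘(ℝ, E))) s (extChartAt 𝓘(ℝ, E) x x) = 0 := by
    intro s
    refine ((mpullbackWithin_extend v).lieBracketWithin_vectorField_eq_nhds
      (mpullbackWithin_extend w)).trans ?_
    simp [VectorField.lieBracketWithin]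
  rw [h]
  exact map_zero _

/-- Symmetry of the Christoffel symbols: torsion reduces to this difference because the bracket
vanishes. -/
theorem cov_extend_symm [FiniteDimensional ℝ E]
     {cov : CovariantDerivative 𝓘(ℝ, E) E (fun x : M => TangentSpace 𝓘(ℝ, E) x)}
    (hcov : cov.torsion = 0) {x : M} (v w : TangentSpace 𝓘(ℝ, E) x) :
    cov (FiberBundle.extend E v) x w = cov (FiberBundle.extend E w) x v := by
  have h := cov.torsion_apply_eq_extend w v
  rw [hcov, mlieBracket_extend] at h
  simp only [FiberBundle.extend_apply_self, Pi.zero_apply, zero_apply,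
    sub_zero] at h
  exact (sub_eq_zero.1 h.symm)

end Symmetry

end BiSlant
end

/-! ### Tensoriality and symmetry of the second fundamental form -/

noncomputable section

namespace BiSlant

section SecondFundamentalForm

variable {E₁ : Type*} [NormedAddCommGroup E₁] [NormedSpace ℝ E₁]
  {N : Type*} [TopologicalSpace N] [ChartedSpace E₁ N] [IsManifold 𝓘(ℝ, E₁) ∞ N]
  {E₂ : Type*} [NormedAddCommGroup E₂] [NormedSpace ℝ E₂]
  {M : Type*} [TopologicalSpace M] [ChartedSpace E₂ M] [IsManifold 𝓘(ℝ, E₂) ∞ M]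
  {F : N → M} {p : N}

theorem SmoothAlongAt.pushforward (hF : ContMDiff 𝓘(ℝ, E₁) 𝓘(ℝ, E₂) ∞ F)
    {Y : Π p : N, TangentSpace 𝓘(ℝ, E₁) p}
    (hY : SmoothAlongAt (E₁ := E₁) (fun q : N => q) Y p) :
    SmoothAlongAt (E₁ := E₁) F (pushforward (E₁ := E₁) (E₂ := E₂) F Y) p :=
  ContMDiffAt.comp p ((hF.contMDiff_tangentMap (m := ∞) (by simp)).contMDiffAt) hY

theorem MDiffAlongAt.pushforward (hF : ContMDiff 𝓘(ℝ, E₁) 𝓘(ℝ, E₂) ∞ F)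
    {Y : Π p : N, TangentSpace 𝓘(ℝ, E₁) p}
    (hY : MDiffAlongAt (E₁ := E₁) (fun q : N => q) Y p) :
    MDiffAlongAt (E₁ := E₁) F (pushforward (E₁ := E₁) (E₂ := E₂) F Y) p :=
  MDifferentiableAt.comp p
    (((hF.contMDiff_tangentMap (m := ∞) (by simp)).contMDiffAt).mdifferentiableAt (by simp)) hY

/-- The expression of `F` in the preferred charts. -/
def chartExpr (E₁ : Type*) [NormedAddCommGroup E₁] [NormedSpace ℝ E₁] [ChartedSpace E₁ N]
    (E₂ : Type*) [NormedAddCommGroup E₂] [NormedSpace ℝ E₂] [ChartedSpace E₂ M]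
    (F : N → M) (p : N) : E₁ → E₂ :=
  extChartAt 𝓘(ℝ, E₂) (F p) ∘ F ∘ (extChartAt 𝓘(ℝ, E₁) p).symm

omit [IsManifold 𝓘(ℝ, E₁) ∞ N] [IsManifold 𝓘(ℝ, E₂) ∞ M] in
theorem contDiffAt_chartExpr (hF : ContMDiff 𝓘(ℝ, E₁) 𝓘(ℝ, E₂) ∞ F) :
    ContDiffAt ℝ ∞ (chartExpr E₁ E₂ F p) (extChartAt 𝓘(ℝ, E₁) p p) := by
  have h := (contMDiffAt_iff.1 (hF p)).2
  rw [modelWithCornersSelf_coe, Set.range_id, contDiffWithinAt_univ] at h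
  exact h

/-- The tangent trivializations are the derivatives of the charts, so the chain rule collapses
chart, `F_*` and inverse chart into one Fréchet derivative. -/
theorem coordAlong_pushforward_extend (hF : ContMDiff 𝓘(ℝ, E₁) 𝓘(ℝ, E₂) ∞ F)
    (v : TangentSpace 𝓘(ℝ, E₁) p) :
    coordAlong F (pushforward F (FiberBundle.extend E₁ v)) p =ᶠ[𝓝 p]
      fun q => fderiv ℝ (chartExpr E₁ E₂ F p) (extChartAt 𝓘(ℝ, E₁) p q) v := by
  -- At its own centre the preferred trivialization is the identity.
  have hv : (trivializationAt E₁ (fun y : N => TangentSpace 𝓘(ℝ, E₁) y) p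
      (TotalSpace.mk' E₁ p v)).2 = v := by
    have h1 := TangentBundle.continuousLinearMapAt_trivializationAt (I := 𝓘(ℝ, E₁))
      (mem_chart_source E₁ p)
    rw [mfderiv_extChartAt_self] at h1
    refine Eq.trans ?_ (DFunLike.congr_fun h1 v)
    exact (Trivialization.continuousLinearMapAt_apply_of_mem _ _
      (FiberBundle.mem_baseSet_trivializationAt' (F := E₁)
        (E := fun y : N => TangentSpace 𝓘(ℝ, E₁) y) p) v).symm
  filter_upwards [eventually_mem_baseSet hF p, eventually_mem_baseSet_trivializationAt (E := E₁) p,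
    (extChartAt_source_mem_nhds (I := 𝓘(ℝ, E₁)) p)] with q hq hb hs
  have hs' : q ∈ (chartAt E₁ p).source := by rwa [extChartAt_source] at hs
  have hq' : F q ∈ (chartAt E₂ (F p)).source := hq
  have ht := (extChartAt 𝓘(ℝ, E₁) p).map_source hs
  have hinv := (extChartAt 𝓘(ℝ, E₁) p).left_inv hs
  have h3 := TangentBundle.symmL_trivializationAt (I := 𝓘(ℝ, E₁)) hs'
  have h4 := TangentBundle.continuousLinearMapAt_trivializationAt (I := 𝓘(ℝ, E₂)) hq'
  let A : E₁ →L[ℝ] E₁ := (trivializationAt E₁ (TangentSpace 𝓘(ℝ, E₁)) p).symmL ℝ q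
  let B : E₁ →L[ℝ] E₂ := differential (E₁ := E₁) (E₂ := E₂) F q
  let C : E₂ →L[ℝ] E₂ :=
    (trivializationAt E₂ (TangentSpace 𝓘(ℝ, E₂)) (F p)).continuousLinearMapAt ℝ (F q)
  have hA : HasMFDerivAt 𝓘(ℝ, E₁) 𝓘(ℝ, E₁) (extChartAt 𝓘(ℝ, E₁) p).symm
      (extChartAt 𝓘(ℝ, E₁) p q) A := by
    have := (mdifferentiableWithinAt_extChartAt_symm (I := 𝓘(ℝ, E₁)) ht).hasMFDerivWithinAt
    rw [← h3, modelWithCornersSelf_coe, Set.range_id] at this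
    exact hasMFDerivWithinAt_univ.1 this
  -- The composition is taken at the chart's image of `q` pulled back, which equals `q` only
  -- propositionally; hence the free `q'`.
  have hB : ∀ q', q' = q → HasMFDerivAt 𝓘(ℝ, E₁) 𝓘(ℝ, E₂) F q' B := by
    rintro _ rfl
    exact (hF.mdifferentiableAt (by simp)).hasMFDerivAt
  have hC : ∀ y, y = F q → HasMFDerivAt 𝓘(ℝ, E₂) 𝓘(ℝ, E₂) (extChartAt 𝓘(ℝ, E₂) (F p)) y C := by
    rintro _ rfl
    have := (mdifferentiableAt_extChartAt (I := 𝓘(ℝ, E₂)) hq').hasMFDerivAt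
    rw [← h4] at this
    exact this
  have hD : HasFDerivAt (chartExpr E₁ E₂ F p) ((C.comp B).comp A) (extChartAt 𝓘(ℝ, E₁) p q) :=
    hasMFDerivAt_iff_hasFDerivAt.1
      (((hC _ (congrArg F hinv)).comp _ (hB _ hinv)).comp (extChartAt 𝓘(ℝ, E₁) p q) hA)
  rw [hD.fderiv]
  have e1 : (FiberBundle.extend E₁ v q : TangentSpace 𝓘(ℝ, E₁) q) = A v := by
    refine Eq.trans ?_ (Trivialization.symmL_apply _ hb v).symm
    exact congrArg (Trivialization.symm (trivializationAt E₁ (TangentSpace 𝓘(ℝ, E₁)) p) q) hv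
  refine Eq.trans ?_ (Trivialization.continuousLinearMapAt_apply_of_mem _ _ hq (B (A v))).symm
  exact congrArg (fun z : TangentSpace 𝓘(ℝ, E₁) q =>
    (trivializationAt E₂ (fun x : M => TangentSpace 𝓘(ℝ, E₂) x) (F p)
      (TotalSpace.mk' E₂ (F q) (differential F q z))).2) e1

/-- Both sides are the second derivative of the chart expression of `F`, which is symmetric. -/
theorem mvfderiv_coordAlong_pushforward_extend_symm (hF : ContMDiff 𝓘(ℝ, E₁) 𝓘(ℝ, E₂) ∞ F)
    (v w : TangentSpace 𝓘(ℝ, E₁) p) :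
    mvfderiv 𝓘(ℝ, E₁) (coordAlong (E₂ := E₂) F (pushforward F (FiberBundle.extend E₁ v)) p) p w
      = mvfderiv 𝓘(ℝ, E₁) (coordAlong (E₂ := E₂) F (pushforward F (FiberBundle.extend E₁ w)) p) p v := by
  have hf := contDiffAt_chartExpr (p := p) hF
  have hsymm := hf.isSymmSndFDerivAt (by simpa using ENat.LEInfty.out)
  have hd : DifferentiableAt ℝ (fderiv ℝ (chartExpr E₁ E₂ F p)) (extChartAt 𝓘(ℝ, E₁) p p) :=
    (hf.fderiv_right (m := ∞) (by simp)).differentiableAt (by simp)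
  have key : ∀ v w : TangentSpace 𝓘(ℝ, E₁) p, mvfderiv 𝓘(ℝ, E₁)
      (coordAlong (E₂ := E₂) F (pushforward F (FiberBundle.extend E₁ v)) p) p w
      = fderiv ℝ (fderiv ℝ (chartExpr E₁ E₂ F p)) (extChartAt 𝓘(ℝ, E₁) p p) w v := by
    intro v w
    rw [mvfderiv_congr (coordAlong_pushforward_extend hF v)]
    have h1 : HasMFDerivAt 𝓘(ℝ, E₁) 𝓘(ℝ, E₁) (extChartAt 𝓘(ℝ, E₁) p) p
        (ContinuousLinearMap.id ℝ E₁) := by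
      have := (mdifferentiableAt_extChartAt (I := 𝓘(ℝ, E₁))
        (mem_chart_source E₁ p)).hasMFDerivAt
      rwa [mfderiv_extChartAt_self] at this
    have h2 : ∀ v : E₁, HasFDerivAt (fun y => fderiv ℝ (chartExpr E₁ E₂ F p) y v)
        ((fderiv ℝ (fderiv ℝ (chartExpr E₁ E₂ F p)) (extChartAt 𝓘(ℝ, E₁) p p)).flip v)
        (extChartAt 𝓘(ℝ, E₁) p p) := fun v => by
      simpa using hd.hasFDerivAt.clm_apply (hasFDerivAt_const v _)
    exact DFunLike.congr_fun ((h2 v).hasMFDerivAt.comp p h1).mfderiv w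
  rw [key, key]
  exact hsymm w v

variable [FiniteDimensional ℝ E₁]
  {cov₁ : CovariantDerivative 𝓘(ℝ, E₁) E₁ (fun x : N => TangentSpace 𝓘(ℝ, E₁) x)}
  {cov₂ : CovariantDerivative 𝓘(ℝ, E₂) E₂ (fun x : M => TangentSpace 𝓘(ℝ, E₂) x)}

/-- The second fundamental form depends only on the values of the vector fields at the point. -/
theorem secondFundamentalForm_congr (hF : ContMDiff 𝓘(ℝ, E₁) 𝓘(ℝ, E₂) ∞ F)
    {X X' Y Y' : Π p : N, TangentSpace 𝓘(ℝ, E₁) p}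
    (hY : MDiffAlongAt (E₁ := E₁) (fun q : N => q) Y p)
    (hY' : MDiffAlongAt (E₁ := E₁) (fun q : N => q) Y' p) (hX : X p = X' p) (h : Y p = Y' p) :
    secondFundamentalForm cov₁ cov₂ F X Y p = secondFundamentalForm cov₁ cov₂ F X' Y' p := by
  unfold secondFundamentalForm
  rw [hX]
  refine eq_of_tensorial_along (F := fun q : N => q) contMDiff_id
    (fun Y => pullbackCov cov₂ F (pushforward F Y) p (X' p) - differential F p (cov₁ Y p (X' p)))
    ?_ ?_ hY hY' h
  -- Both terms produce `df(X') • F_* V`, and these cancel.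
  · intro f V hf hV
    have h1 : cov₁ (fun q => f q • V q) p = _ := cov₁.isCovariantDerivativeOnUniv.leibniz hV hf
    have h2 : pushforward (E₂ := E₂) F (fun q => f q • V q)
        = fun q => f q • pushforward F V q := funext fun q => map_smul _ _ _
    rw [h1, h2, pullbackCov_smul cov₂ hF hf (hV.pushforward hF)]
    simp only [add_apply, smul_apply, map_add, map_smul, ContinuousLinearMap.smulRight_apply,
      pushforward]
    module
  · intro V W hV hW
    have h1 : cov₁ (fun q => V q + W q) p = _ := cov₁.isCovariantDerivativeOnUniv.add hV hW
    have h2 : pushforward (E₂ := E₂) F (fun q => V q + W q)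
        = fun q => pushforward F V q + pushforward F W q := funext fun q => map_add _ _ _
    rw [h1, h2, pullbackCov_add cov₂ hF (hV.pushforward hF) (hW.pushforward hF)]
    simp only [add_apply, map_add]
    abel

/-- The second fundamental form is symmetric. -/
theorem secondFundamentalForm_symm [FiniteDimensional ℝ E₂] (h₁ : cov₁.torsion = 0)
    (h₂ : cov₂.torsion = 0) (hF : ContMDiff 𝓘(ℝ, E₁) 𝓘(ℝ, E₂) ∞ F)
    {X Y : Π p : N, TangentSpace 𝓘(ℝ, E₁) p}
    (hX : MDiffAlongAt (E₁ := E₁) (fun q : N => q) X p)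
    (hY : MDiffAlongAt (E₁ := E₁) (fun q : N => q) Y p) :
    secondFundamentalForm cov₁ cov₂ F X Y p = secondFundamentalForm cov₁ cov₂ F Y X p := by
  have hX' := FiberBundle.extend_apply_self (F := E₁) (X p)
  have hY' := FiberBundle.extend_apply_self (F := E₁) (Y p)
  rw [secondFundamentalForm_congr (X' := FiberBundle.extend E₁ (X p))
      (Y' := FiberBundle.extend E₁ (Y p)) hF hY (mdifferentiableAt_extend _) hX'.symm hY'.symm,
    secondFundamentalForm_congr (X' := FiberBundle.extend E₁ (Y p))
      (Y' := FiberBundle.extend E₁ (X p)) hF hX (mdifferentiableAt_extend _) hY'.symm hX'.symm]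
  simp only [secondFundamentalForm, pullbackCov_apply, hX', hY', pushforward]
  -- On constant-coordinate extensions, three separately symmetric pieces remain: second derivatives
  -- of `F` and the Christoffel terms of source and target.
  have e1 := mvfderiv_coordAlong_pushforward_extend_symm hF (X p) (Y p)
  have e2 := cov_extend_symm h₁ (X p) (Y p)
  have e3 := cov_extend_symm h₂ (differential (E₂ := E₂) F p (X p)) (differential F p (Y p))
  rw [e1, e2, e3]

omit [FiniteDimensional ℝ E₁] in
/-- The second fundamental form is additive in the first argument. -/
theorem secondFundamentalForm_add_left {X X' Y : Π p : N, TangentSpace 𝓘(ℝ, E₁) p} :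
    secondFundamentalForm cov₁ cov₂ F (fun q => X q + X' q) Y p
      = secondFundamentalForm cov₁ cov₂ F X Y p + secondFundamentalForm cov₁ cov₂ F X' Y p := by
  simp only [secondFundamentalForm, map_add]
  abel

end SecondFundamentalForm

end BiSlant
end

/-! ### Smoothness of orthogonal projections -/

noncomputable section

namespace BiSlant

section Gram

variable {E₁ : Type*} [NormedAddCommGroup E₁] [NormedSpace ℝ E₁]
  {N : Type*} [TopologicalSpace N] [ChartedSpace E₁ N] {p : N}

theorem contMDiffAt_det {n : Type*} [Fintype n] [DecidableEq n] {A : N → Matrix n n ℝ}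
    (hA : ∀ i j, ContMDiffAt 𝓘(ℝ, E₁) 𝓘(ℝ, ℝ) ∞ (fun q => A q i j) p) :
    ContMDiffAt 𝓘(ℝ, E₁) 𝓘(ℝ, ℝ) ∞ (fun q => (A q).det) p := by
  simp only [Matrix.det_apply']
  refine contMDiffAt_finsetSum fun σ _ => ?_
  exact contMDiffAt_const.mul (contMDiffAt_finsetProd fun i _ => hA _ _)

theorem contMDiffAt_inv_apply {n : Type*} [Fintype n] [DecidableEq n] {A : N → Matrix n n ℝ}
    (hA : ∀ i j, ContMDiffAt 𝓘(ℝ, E₁) 𝓘(ℝ, ℝ) ∞ (fun q => A q i j) p) (hdet : (A p).det ≠ 0)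
    (i j : n) : ContMDiffAt 𝓘(ℝ, E₁) 𝓘(ℝ, ℝ) ∞ (fun q => (A q)⁻¹ i j) p := by
  simp only [Matrix.inv_def, Matrix.smul_apply, smul_eq_mul, Ring.inverse_eq_inv',
    Matrix.adjugate_apply]
  refine ContMDiffAt.mul ((contMDiffAt_det hA).inv₀ hdet) (contMDiffAt_det fun i' j' => ?_)
  by_cases h : i' = j
  · subst h
    simp only [Matrix.updateRow_self]
    exact contMDiffAt_const
  · simp only [Matrix.updateRow_ne h]
    exact hA _ _

variable {E₂ : Type*} [NormedAddCommGroup E₂] [NormedSpace ℝ E₂]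
  {M : Type*} [TopologicalSpace M] [ChartedSpace E₂ M] [IsManifold 𝓘(ℝ, E₂) ∞ M]
  [RiemannianBundle (fun x : M => TangentSpace 𝓘(ℝ, E₂) x)]
  [IsContMDiffRiemannianBundle 𝓘(ℝ, E₂) ∞ E₂ (fun x : M => TangentSpace 𝓘(ℝ, E₂) x)]
  {F : N → M}

/-- A section of the span of a smooth frame whose inner products with the frame are smooth is
smooth. -/
theorem smoothAlongAt_of_inner_frame (hF : ContMDiff 𝓘(ℝ, E₁) 𝓘(ℝ, E₂) ∞ F) {n : Type*} [Fintype n]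
    {s : n → Π p : N, TangentSpace 𝓘(ℝ, E₂) (F p)} {Z : Π p : N, TangentSpace 𝓘(ℝ, E₂) (F p)}
    (hs : ∀ i, SmoothAlongAt (E₁ := E₁) F (s i) p)
    (hli : ∀ᶠ q in 𝓝 p, LinearIndependent ℝ (fun i => s i q))
    (hZ : ∀ᶠ q in 𝓝 p, Z q ∈ Submodule.span ℝ (Set.range fun i => s i q))
    (hin : ∀ i, ContMDiffAt 𝓘(ℝ, E₁) 𝓘(ℝ, ℝ) ∞ (fun q => (inner ℝ (Z q) (s i q) : ℝ)) p) :
    SmoothAlongAt (E₁ := E₁) F Z p := by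
  classical
  let G : N → Matrix n n ℝ := fun q => Matrix.gram ℝ (fun i => s i q)
  have hG : ∀ i j, ContMDiffAt 𝓘(ℝ, E₁) 𝓘(ℝ, ℝ) ∞ (fun q => G q i j) p := fun i j =>
    (hs i).inner (hs j)
  have hdet : ∀ᶠ q in 𝓝 p, (G q).det ≠ 0 := hli.mono fun q hq =>
    Matrix.det_gram_ne_zero_iff_linearIndependent.2 hq
  -- The coefficients of `Z` solve the Gram system; Cramer's rule makes them smooth.
  let c : n → N → ℝ := fun i q => ∑ j, (G q)⁻¹ i j * inner ℝ (Z q) (s j q)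
  have hc : ∀ i, ContMDiffAt 𝓘(ℝ, E₁) 𝓘(ℝ, ℝ) ∞ (c i) p := fun i =>
    contMDiffAt_finsetSum fun j _ =>
      (contMDiffAt_inv_apply hG hdet.self_of_nhds i j).mul (hin j)
  have hsmooth : SmoothAlongAt (E₁ := E₁) F (fun q => ∑ i, c i q • s i q) p :=
    SmoothAlongAt.sum hF fun i _ => (hs i).smul hF (hc i)
  refine ContMDiffAt.congr_of_eventuallyEq hsmooth ?_
  filter_upwards [hdet, hZ] with q hq hZq
  obtain ⟨d, hd⟩ := (Submodule.mem_span_range_iff_exists_fun ℝ).1 hZq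
  have h1 : (fun j => (inner ℝ (Z q) (s j q) : ℝ)) = (G q).mulVec d := by
    funext j
    simp only [← hd, sum_inner, real_inner_smul_left, Matrix.mulVec, dotProduct, G,
      Matrix.gram_apply]
    exact Finset.sum_congr rfl fun i _ => by rw [real_inner_comm, mul_comm]
  have h2 : ∀ i, c i q = d i := by
    intro i
    have h3 : (G q)⁻¹.mulVec ((G q).mulVec d) = d := by
      rw [Matrix.mulVec_mulVec, Matrix.nonsing_inv_mul _ (isUnit_iff_ne_zero.2 hq),
        Matrix.one_mulVec]
    rw [← h1] at h3
    exact congrFun h3 i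
  simp only [h2, hd]

variable [FiniteDimensional ℝ E₂]

/-- The orthogonal projection to a smooth distribution along `F` preserves smoothness. -/
theorem SmoothAlongAt.proj (hF : ContMDiff 𝓘(ℝ, E₁) 𝓘(ℝ, E₂) ∞ F)
    {D : Π p : N, Submodule ℝ (TangentSpace 𝓘(ℝ, E₂) (F p))}
    (hD : IsSmoothDistributionAlong (E₁ := E₁) F D) {W : Π p : N, TangentSpace 𝓘(ℝ, E₂) (F p)}
    (hW : SmoothAlongAt (E₁ := E₁) F W p) :
    SmoothAlongAt (E₁ := E₁) F (fun q => BiSlant.proj (D q) (W q)) p := by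
  obtain ⟨k, s, hs⟩ := hD p
  refine smoothAlongAt_of_inner_frame hF hs.self_of_nhds.1 (hs.mono fun q hq => hq.2.1)
    (hs.mono fun q hq => ?_) fun i => ?_
  · rw [hq.2.2]
    exact (D q).starProjection_apply_mem _
  -- Against a frame of `D`, projecting `W` does not change the inner products.
  · refine ContMDiffAt.congr_of_eventuallyEq (hW.inner (hs.self_of_nhds.1 i)) ?_
    filter_upwards [hs] with q hq
    refine inner_starProjection_of_mem_right (D q) (W q) ?_
    rw [← hq.2.2]
    exact Submodule.subset_span ⟨i, rfl⟩

end Gram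

/-! ### Horizontal projection and extension of tangent vectors -/

section Horizontal

variable {E₁ : Type*} [NormedAddCommGroup E₁] [NormedSpace ℝ E₁] [FiniteDimensional ℝ E₁]
  {N : Type*} [TopologicalSpace N] [ChartedSpace E₁ N]
  [RiemannianBundle (fun x : N => TangentSpace 𝓘(ℝ, E₁) x)]
  {E₂ : Type*} [NormedAddCommGroup E₂] [NormedSpace ℝ E₂]
  {M : Type*} [TopologicalSpace M] [ChartedSpace E₂ M]
  {F : N → M} {p : N}

/-- The horizontal part of a tangent vector. -/
def horPart (E₂ : Type*) [NormedAddCommGroup E₂] [NormedSpace ℝ E₂] [ChartedSpace E₂ M]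
    (F : N → M) (p : N) (v : TangentSpace 𝓘(ℝ, E₁) p) : TangentSpace 𝓘(ℝ, E₁) p :=
  (horD (E₁ := E₁) (E₂ := E₂) F p).starProjection v

theorem horPart_mem (v : TangentSpace 𝓘(ℝ, E₁) p) :
    horPart E₂ F p v ∈ horD (E₁ := E₁) (E₂ := E₂) F p :=
  Submodule.starProjection_apply_mem _ v

theorem sub_horPart_mem (v : TangentSpace 𝓘(ℝ, E₁) p) :
    v - horPart E₂ F p v ∈ kerD (E₁ := E₁) (E₂ := E₂) F p := by
  have h := Submodule.sub_starProjection_mem_orthogonal (K := horD (E₁ := E₁) (E₂ := E₂) F p) v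
  rwa [horD, Submodule.orthogonal_orthogonal] at h

theorem differential_horPart (v : TangentSpace 𝓘(ℝ, E₁) p) :
    differential (E₂ := E₂) F p (horPart E₂ F p v) = differential F p v := by
  have h : differential (E₂ := E₂) F p (v - horPart E₂ F p v) = 0 := sub_horPart_mem v
  rw [map_sub] at h
  exact (sub_eq_zero.1 h).symm

/-- `F_*` sees only horizontal parts and is isometric on them; the projection is self-adjoint and
idempotent. -/
theorem IsRiemannianMap.inner_horPart
    [RiemannianBundle (fun x : M => TangentSpace 𝓘(ℝ, E₂) x)]
    (hR : IsRiemannianMap (E₁ := E₁) (E₂ := E₂) F)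
    (v w : TangentSpace 𝓘(ℝ, E₁) p) :
    (inner ℝ (horPart E₂ F p v) w : ℝ)
      = inner ℝ (differential (E₂ := E₂) F p v) (differential F p w) := by
  rw [← differential_horPart v, ← differential_horPart w,
    hR.isometric p _ _ (horPart_mem v) (horPart_mem w)]
  simp only [horPart]
  rw [← inner_starProjection_comm, Submodule.starProjection_eq_self_iff.2
    (Submodule.starProjection_apply_mem _ _)]

/-- No smooth frame of `ker F_*` is needed: `inner_horPart` expresses the inner products with a
frame of the whole tangent bundle through `F_*`. -/
theorem SmoothAlongAt.horPart [IsManifold 𝓘(ℝ, E₁) ∞ N] [IsManifold 𝓘(ℝ, E₂) ∞ M]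
    [RiemannianBundle (fun x : M => TangentSpace 𝓘(ℝ, E₂) x)]
    [IsContMDiffRiemannianBundle 𝓘(ℝ, E₁) ∞ E₁ (fun x : N => TangentSpace 𝓘(ℝ, E₁) x)]
    [IsContMDiffRiemannianBundle 𝓘(ℝ, E₂) ∞ E₂ (fun x : M => TangentSpace 𝓘(ℝ, E₂) x)]
    (hR : IsRiemannianMap (E₁ := E₁) (E₂ := E₂) F) {Y : Π p : N, TangentSpace 𝓘(ℝ, E₁) p}
    (hY : SmoothAlongAt (E₁ := E₁) (fun q : N => q) Y p) :
    SmoothAlongAt (E₁ := E₁) (fun q : N => q) (fun q => BiSlant.horPart E₂ F q (Y q)) p := by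
  let e := trivializationAt E₁ (fun y : N => TangentSpace 𝓘(ℝ, E₁) y) p
  let b := Module.finBasis ℝ E₁
  have hp : p ∈ e.baseSet := FiberBundle.mem_baseSet_trivializationAt' p
  have hframe := e.isLocalFrameOn_localFrame_baseSet 𝓘(ℝ, E₁) ∞ b
  have hev : ∀ᶠ q in 𝓝 p, q ∈ e.baseSet := e.open_baseSet.mem_nhds hp
  have hs : ∀ i, SmoothAlongAt (E₁ := E₁) (fun q : N => q) (e.localFrame b i) p := fun i =>
    hframe.contMDiffAt e.open_baseSet hp i
  refine smoothAlongAt_of_inner_frame (F := fun q : N => q) contMDiff_id hs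
    (hev.mono fun q hq => hframe.linearIndependent hq)
    (hev.mono fun q hq => hframe.generating hq Submodule.mem_top) fun i => ?_
  refine ContMDiffAt.congr_of_eventuallyEq
    ((hY.pushforward hR.smooth).inner ((hs i).pushforward hR.smooth)) ?_
  exact Filter.Eventually.of_forall fun q => hR.inner_horPart _ _

omit [RiemannianBundle (fun x : N => TangentSpace 𝓘(ℝ, E₁) x)] in
/-- Every tangent vector extends to a smooth vector field. -/
theorem exists_isSmoothField [IsManifold 𝓘(ℝ, E₁) ∞ N] [T2Space N] (v : TangentSpace 𝓘(ℝ, E₁) p) :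
    ∃ X : Π p : N, TangentSpace 𝓘(ℝ, E₁) p, IsSmoothField X ∧ X p = v := by
  obtain ⟨s, hs, hsv⟩ := FiberBundle.exists_contMDiffOn_extend 𝓘(ℝ, E₁) E₁ (k := ∞)
    (V := fun y : N => TangentSpace 𝓘(ℝ, E₁) y) v
  obtain ⟨u, hus, hu, hpu⟩ := mem_nhds_iff.1 hs
  -- A bump function supported where the local extension is smooth makes it global; its value at `p`
  -- is `1`.
  obtain ⟨f, -, hf⟩ := ((SmoothBumpFunction.nhds_basis_tsupport (I := 𝓘(ℝ, E₁)) p).mem_iff).1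
    (hu.mem_nhds hpu)
  refine ⟨(f : N → ℝ) • FiberBundle.extend E₁ v,
    ContMDiffOn.smul_section_of_tsupport f.contMDiff.contMDiffOn hu hf (hsv.mono hus), ?_⟩
  simp

end Horizontal

end BiSlant
end

/-! ### The normal derivative identity for bi-slant maps -/

noncomputable section

namespace BiSlant

variable {E₁ : Type*} [NormedAddCommGroup E₁] [NormedSpace ℝ E₁]
  {N : Type*} [TopologicalSpace N] [ChartedSpace E₁ N]
  {E₂ : Type*} [NormedAddCommGroup E₂] [NormedSpace ℝ E₂] [FiniteDimensional ℝ E₂]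
  {M : Type*} [TopologicalSpace M] [ChartedSpace E₂ M] [IsManifold 𝓘(ℝ, E₂) ∞ M]
  [RiemannianBundle (fun x : M => TangentSpace 𝓘(ℝ, E₂) x)]
  {F : N → M} {p : N}

section Parts

omit [IsManifold 𝓘(ℝ, E₂) ∞ M]

theorem tanPart_add_norPart (w : TangentSpace 𝓘(ℝ, E₂) (F p)) :
    tanPart (E₁ := E₁) F p w + norPart (E₁ := E₁) F p w = w :=
  Submodule.starProjection_add_starProjection_orthogonal _

theorem inner_tanPart (v w : TangentSpace 𝓘(ℝ, E₂) (F p)) :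
    (inner ℝ (tanPart (E₁ := E₁) F p v) (tanPart (E₁ := E₁) F p w) : ℝ)
      = inner ℝ v (tanPart (E₁ := E₁) F p w) :=
  inner_starProjection_of_mem_right _ _ (Submodule.starProjection_apply_mem _ _)

theorem inner_norPart (v w : TangentSpace 𝓘(ℝ, E₂) (F p)) :
    (inner ℝ (norPart (E₁ := E₁) F p v) (norPart (E₁ := E₁) F p w) : ℝ)
      = inner ℝ v (norPart (E₁ := E₁) F p w) :=
  inner_starProjection_of_mem_right _ _ (Submodule.starProjection_apply_mem _ _)

theorem inner_norPart_of_mem (v : TangentSpace 𝓘(ℝ, E₂) (F p)) {w : TangentSpace 𝓘(ℝ, E₂) (F p)}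
    (hw : w ∈ (rangeD (E₁ := E₁) F p)ᗮ) :
    (inner ℝ (norPart (E₁ := E₁) F p v) w : ℝ) = inner ℝ v w :=
  inner_starProjection_of_mem_right _ _ hw

end Parts

variable {ψ : Π x : M, TangentSpace 𝓘(ℝ, E₂) x →L[ℝ] TangentSpace 𝓘(ℝ, E₂) x}
  {ξ : Π x : M, TangentSpace 𝓘(ℝ, E₂) x} {η : Π x : M, TangentSpace 𝓘(ℝ, E₂) x →L[ℝ] ℝ}
  {cov : CovariantDerivative 𝓘(ℝ, E₂) E₂ (fun x : M => TangentSpace 𝓘(ℝ, E₂) x)}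
  {D₁ D₂ : Π p : N, Submodule ℝ (TangentSpace 𝓘(ℝ, E₂) (F p))} {θ₁ θ₂ : ℝ}
  [RiemannianBundle (fun x : N => TangentSpace 𝓘(ℝ, E₁) x)]
  [IsContMDiffRiemannianBundle 𝓘(ℝ, E₂) ∞ E₂ (fun x : M => TangentSpace 𝓘(ℝ, E₂) x)]

omit [FiniteDimensional ℝ E₂]
  [IsContMDiffRiemannianBundle 𝓘(ℝ, E₂) ∞ E₂ (fun x : M => TangentSpace 𝓘(ℝ, E₂) x)] in
theorem IsAlmostContactMetric.inner_ξ_ξ (hM : IsAlmostContactMetric ψ ξ η) (x : M) :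
    (inner ℝ (ξ x) (ξ x) : ℝ) = 1 := by
  rw [← hM.η_eq_inner, hM.η_ξ]

omit [IsContMDiffRiemannianBundle 𝓘(ℝ, E₂) ∞ E₂ (fun x : M => TangentSpace 𝓘(ℝ, E₂) x)] in
-- Yields smoothness of the tangential projection from that of its three summands.
theorem IsBiSlant.tanPart_eq (hM : IsAlmostContactMetric ψ ξ η)
    (hF : IsBiSlant (E₁ := E₁) F ψ ξ D₁ D₂ θ₁ θ₂) (p : N) (w : TangentSpace 𝓘(ℝ, E₂) (F p)) :
    tanPart (E₁ := E₁) F p w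
      = proj (D₁ p) w + proj (D₂ p) w + (inner ℝ w (ξ (F p)) : ℝ) • ξ (F p) :=
  starProjection_eq_add_add (hF.range_eq p) (hF.orthogonal p) (hF.orthogonal_ξ₁ p)
    (hF.orthogonal_ξ₂ p) (hM.inner_ξ_ξ (F p)) w

omit [IsContMDiffRiemannianBundle 𝓘(ℝ, E₂) ∞ E₂ (fun x : M => TangentSpace 𝓘(ℝ, E₂) x)] in
/-- `P² W = -cos² θ₁ σ W - cos² θ₂ τ W`, where `σ` and `τ` are the projections to `D₁` and `D₂`. -/
theorem IsBiSlant.tanψ_tanψ (hM : IsAlmostContactMetric ψ ξ η)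
    (hF : IsBiSlant (E₁ := E₁) F ψ ξ D₁ D₂ θ₁ θ₂) (p : N) {w : TangentSpace 𝓘(ℝ, E₂) (F p)}
    (hw : w ∈ rangeD (E₁ := E₁) F p) :
    tanψ (E₁ := E₁) F ψ p (tanψ (E₁ := E₁) F ψ p w)
      = -(Real.cos θ₁ ^ 2 • proj (D₁ p) w)
        - Real.cos θ₂ ^ 2 • (w - proj (D₁ p) w - (inner ℝ w (ξ (F p)) : ℝ) • ξ (F p)) := by
  refine starProjection_comp_sq_of_biSlant (hF.range_eq p) (hF.orthogonal p) (hF.orthogonal_ξ₁ p)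
    (hF.orthogonal_ξ₂ p) (hM.inner_ξ_ξ (F p)) (ψ (F p)) (hM.ψ_ξ _) θ₁ θ₂ (hM.inner_ψ_left _) ?_
    (hF.slant₁.angle_eq p) (hF.slant₂.angle_eq p) (hF.ψ_orthogonal₁ p) (hF.ψ_orthogonal₂ p) hw
  intro v hv
  rw [hM.inner_ψ_ψ, hM.η_eq_inner, hv]
  ring

omit [FiniteDimensional ℝ E₂]
  [RiemannianBundle (fun x : N => TangentSpace 𝓘(ℝ, E₁) x)]
  [IsContMDiffRiemannianBundle 𝓘(ℝ, E₂) ∞ E₂ (fun x : M => TangentSpace 𝓘(ℝ, E₂) x)] in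
theorem smoothAlongAt_reeb (hM : IsAlmostContactMetric ψ ξ η)
    (hF : ContMDiff 𝓘(ℝ, E₁) 𝓘(ℝ, E₂) ∞ F) :
    SmoothAlongAt (E₁ := E₁) F (fun q => ξ (F q)) p :=
  ContMDiffAt.comp p hM.smooth_ξ.contMDiffAt hF.contMDiffAt

theorem SmoothAlongAt.tanPart (hM : IsAlmostContactMetric ψ ξ η)
    (hF : IsBiSlant (E₁ := E₁) F ψ ξ D₁ D₂ θ₁ θ₂) {W : Π p : N, TangentSpace 𝓘(ℝ, E₂) (F p)}
    (hW : SmoothAlongAt (E₁ := E₁) F W p) :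
    SmoothAlongAt (E₁ := E₁) F (fun q => BiSlant.tanPart (E₁ := E₁) F q (W q)) p := by
  have hs := hF.riemannianMap.smooth
  have hξ := smoothAlongAt_reeb (p := p) hM hs
  simp only [hF.tanPart_eq hM]
  exact ((hW.proj hs hF.slant₁.smooth).add hs (hW.proj hs hF.slant₂.smooth)).add hs
    (hξ.smul hs (hW.inner hξ))

theorem SmoothAlongAt.norPart (hM : IsAlmostContactMetric ψ ξ η)
    (hF : IsBiSlant (E₁ := E₁) F ψ ξ D₁ D₂ θ₁ θ₂) {W : Π p : N, TangentSpace 𝓘(ℝ, E₂) (F p)}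
    (hW : SmoothAlongAt (E₁ := E₁) F W p) :
    SmoothAlongAt (E₁ := E₁) F (fun q => BiSlant.norPart (E₁ := E₁) F q (W q)) p := by
  have hs := hF.riemannianMap.smooth
  have h := hW.add hs ((hW.tanPart hM hF).smul hs (f := fun _ => -1) contMDiffAt_const)
  refine Eq.mp (congrArg (fun Z => SmoothAlongAt (E₁ := E₁) F Z p) (funext fun q => ?_)) h
  have := tanPart_add_norPart (E₁ := E₁) (F := F) (p := q) (W q)
  rw [neg_one_smul, ← sub_eq_add_neg, sub_eq_iff_eq_add, add_comm, this]

/-- The covariant derivatives of `W`, of its projection to `D₁`, and of the normal parts of `ψ W`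
and `ψ P W`, for a section `W` of `range F_*` of a bi-slant map into a Kenmotsu manifold. -/
theorem IsBiSlant.inner_pullbackCov (hM : IsKenmotsu cov ψ ξ η)
    (hF : IsBiSlant (E₁ := E₁) F ψ ξ D₁ D₂ θ₁ θ₂) {W : Π p : N, TangentSpace 𝓘(ℝ, E₂) (F p)}
    (hW : SmoothAlongAt (E₁ := E₁) F W p) (hWr : ∀ q, W q ∈ rangeD (E₁ := E₁) F q)
    (u : TangentSpace 𝓘(ℝ, E₁) p) {V : TangentSpace 𝓘(ℝ, E₂) (F p)}
    (hV : V ∈ (rangeD (E₁ := E₁) F p)ᗮ) :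
    inner ℝ (pullbackCov cov F W p u) V
      + (Real.cos θ₂ ^ 2 - Real.cos θ₁ ^ 2) *
          inner ℝ (pullbackCov cov F (fun q => proj (D₁ q) (W q)) p u) V
      = Real.cos θ₂ ^ 2 * inner ℝ (pullbackCov cov F W p u) V
        - inner ℝ (normalCov cov F (fun q => norψ (E₁ := E₁) F ψ q
            (tanψ (E₁ := E₁) F ψ q (W q))) p u) V
        - inner ℝ (shapeOp cov F (fun q => norψ (E₁ := E₁) F ψ q (W q)) p u)
            (tanψ (E₁ := E₁) F ψ p V)
        + inner ℝ (normalCov cov F (fun q => norψ (E₁ := E₁) F ψ q (W q)) p u)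
            (norψ (E₁ := E₁) F ψ p V) := by
  have hA := hM.toIsAlmostContactMetric
  have hs := hF.riemannianMap.smooth
  set w := differential (E₂ := E₂) F p u with hw
  have hξr : ξ (F p) ∈ rangeD (E₁ := E₁) F p := by
    rw [hF.range_eq p]
    exact Submodule.mem_sup_right (Submodule.mem_span_singleton_self _)
  have hwr : w ∈ rangeD (E₁ := E₁) F p := ⟨u, rfl⟩
  -- Since `ξ` and `F_* u` are tangent and `V` is normal, these vanishings remove the Kenmotsu
  -- corrections in `e1`; `e2` also uses `hηP`.
  have hξV : (inner ℝ (ξ (F p)) V : ℝ) = 0 := hV _ hξr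
  have hwV : (inner ℝ w V : ℝ) = 0 := hV _ hwr
  have hηV : η (F p) V = 0 := by rw [hA.η_eq_inner, real_inner_comm, hξV]
  have hξψ : (inner ℝ (ξ (F p)) (ψ (F p) V) : ℝ) = 0 := by
    rw [real_inner_comm, hA.inner_ψ_left, hA.ψ_ξ, inner_zero_right, neg_zero]
  have hwψ : (inner ℝ (ψ (F p) w) (ψ (F p) V) : ℝ) = 0 := by
    rw [hA.inner_ψ_ψ, hwV, hηV]; ring
  have hψW := hW.contactTensor hA hs
  have hP : SmoothAlongAt (E₁ := E₁) F (fun q => tanψ (E₁ := E₁) F ψ q (W q)) p :=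
    hψW.tanPart hA hF
  have hQ : SmoothAlongAt (E₁ := E₁) F (fun q => norψ (E₁ := E₁) F ψ q (W q)) p :=
    hψW.norPart hA hF
  have hψP := hP.contactTensor hA hs
  have hPP : SmoothAlongAt (E₁ := E₁) F
      (fun q => tanψ (E₁ := E₁) F ψ q (tanψ (E₁ := E₁) F ψ q (W q))) p := hψP.tanPart hA hF
  have hQP : SmoothAlongAt (E₁ := E₁) F
      (fun q => norψ (E₁ := E₁) F ψ q (tanψ (E₁ := E₁) F ψ q (W q))) p := hψP.norPart hA hF
  have hσ := hW.proj hs hF.slant₁.smooth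
  have hξ := smoothAlongAt_reeb (p := p) hA hs
  -- the normal components on the right-hand side
  have r1 : (inner ℝ (normalCov cov F (fun q => norψ (E₁ := E₁) F ψ q
      (tanψ (E₁ := E₁) F ψ q (W q))) p u) V : ℝ) = inner ℝ (pullbackCov cov F
      (fun q => norψ (E₁ := E₁) F ψ q (tanψ (E₁ := E₁) F ψ q (W q))) p u) V :=
    inner_norPart_of_mem _ hV
  -- The sign in the shape operator cancels, and `φV + ωV = ψV` reassembles one pairing.
  have r2 : -(inner ℝ (shapeOp cov F (fun q => norψ (E₁ := E₁) F ψ q (W q)) p u)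
        (tanψ (E₁ := E₁) F ψ p V) : ℝ)
      + inner ℝ (normalCov cov F (fun q => norψ (E₁ := E₁) F ψ q (W q)) p u)
          (norψ (E₁ := E₁) F ψ p V)
      = inner ℝ (pullbackCov cov F (fun q => norψ (E₁ := E₁) F ψ q (W q)) p u) (ψ (F p) V) := by
    unfold shapeOp normalCov tanψ norψ
    rw [inner_neg_left, neg_neg, inner_tanPart, inner_norPart, ← inner_add_right,
      tanPart_add_norPart]
  -- the derivative of `ψ W = P W + Q W`
  have s1 := pullbackCov_contactTensor hM hs hW.mdiffAlongAt u
  have d1 : (fun q => ψ (F q) (W q))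
      = fun q => tanψ (E₁ := E₁) F ψ q (W q) + norψ (E₁ := E₁) F ψ q (W q) :=
    funext fun q => (tanPart_add_norPart _).symm
  rw [d1, pullbackCov_add cov hs hP.mdiffAlongAt hQ.mdiffAlongAt] at s1
  -- Pairing with `ψV` recovers `⟪∇W, V⟫`, because `ψ` preserves inner products with `V` when `η(V)
  -- = 0`.
  have e1 := congrArg (fun z => (inner ℝ z (ψ (F p) V) : ℝ)) s1
  simp only [inner_sub_left, inner_add_left, real_inner_smul_left, hA.inner_ψ_ψ, hηV, hξψ, ← hw,
    hwV] at e1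
  -- the derivative of `ψ P W = P² W + Q P W`
  have s2 := pullbackCov_contactTensor hM hs hP.mdiffAlongAt u
  have d2 : (fun q => ψ (F q) (tanψ (E₁ := E₁) F ψ q (W q)))
      = fun q => tanψ (E₁ := E₁) F ψ q (tanψ (E₁ := E₁) F ψ q (W q))
        + norψ (E₁ := E₁) F ψ q (tanψ (E₁ := E₁) F ψ q (W q)) :=
    funext fun q => (tanPart_add_norPart _).symm
  rw [d2, pullbackCov_add cov hs hPP.mdiffAlongAt hQP.mdiffAlongAt] at s2
  have hηP : η (F p) (tanψ (E₁ := E₁) F ψ p (W p)) = 0 := by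
    rw [hA.η_eq_inner]
    refine (inner_starProjection_of_mem_right _ _ hξr).trans ?_
    rw [hA.inner_ψ_left, hA.ψ_ξ, inner_zero_right, neg_zero]
  have e2 := congrArg (fun z => (inner ℝ z V : ℝ)) s2
  simp only [inner_sub_left, inner_add_left, real_inner_smul_left, hξV, hηP,
    hA.inner_ψ_left _ _ V] at e2
  -- the derivative of `P² W`
  have d3 : (fun q => tanψ (E₁ := E₁) F ψ q (tanψ (E₁ := E₁) F ψ q (W q)))
      = fun q => ((Real.cos θ₂ ^ 2 - Real.cos θ₁ ^ 2) • proj (D₁ q) (W q)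
        + (-Real.cos θ₂ ^ 2) • W q)
        + (Real.cos θ₂ ^ 2 * inner ℝ (W q) (ξ (F q)) : ℝ) • ξ (F q) := by
    funext q
    rw [hF.tanψ_tanψ hA q (hWr q)]
    module
  have hf : ContMDiffAt 𝓘(ℝ, E₁) 𝓘(ℝ, ℝ) ∞
      (fun q => (Real.cos θ₂ ^ 2 * inner ℝ (W q) (ξ (F q)) : ℝ)) p :=
    contMDiffAt_const.mul (hW.inner hξ)
  have hc : ∀ c : ℝ, ContMDiffAt 𝓘(ℝ, E₁) 𝓘(ℝ, ℝ) ∞ (fun _ : N => c) p :=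
    fun c => contMDiffAt_const
  have hcσ := hσ.smul hs (hc (Real.cos θ₂ ^ 2 - Real.cos θ₁ ^ 2))
  have hcW := hW.smul hs (hc (-Real.cos θ₂ ^ 2))
  -- The derivative of the `ξ` term is a combination of `ξ` and `∇_w ξ = w - η(w)ξ`, all tangent, so
  -- it pairs to zero with `V`.
  have e3 : (inner ℝ (pullbackCov cov F
      (fun q => tanψ (E₁ := E₁) F ψ q (tanψ (E₁ := E₁) F ψ q (W q))) p u) V : ℝ)
      = (Real.cos θ₂ ^ 2 - Real.cos θ₁ ^ 2) *
          inner ℝ (pullbackCov cov F (fun q => proj (D₁ q) (W q)) p u) V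
        - Real.cos θ₂ ^ 2 * inner ℝ (pullbackCov cov F W p u) V := by
    rw [d3, pullbackCov_add cov hs (hcσ.add hs hcW).mdiffAlongAt (hξ.smul hs hf).mdiffAlongAt,
      pullbackCov_add cov hs hcσ.mdiffAlongAt hcW.mdiffAlongAt,
      pullbackCov_smul cov hs ((hc _).mdifferentiableAt (by simp)) hσ.mdiffAlongAt,
      pullbackCov_smul cov hs ((hc _).mdifferentiableAt (by simp)) hW.mdiffAlongAt,
      pullbackCov_smul cov hs (hf.mdifferentiableAt (by simp)) hξ.mdiffAlongAt,
      pullbackCov_comp cov hs (hA.smooth_ξ.mdifferentiableAt (by simp)), hM.cov_ξ, mvfderiv_const,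
      mvfderiv_const, ← hw]
    simp only [inner_sub_left, inner_add_left, real_inner_smul_left, hξV, hwV,
      zero_apply, zero_smul, inner_zero_left]
    ring
  rw [r1]
  -- Subtracting `e2` from `e1` eliminates `⟪∇(PW), ψV⟫`; `e3` then replaces `P²W`.
  linarith

end BiSlant
end

/-! ### Total geodesicity of a Riemannian map, block by block -/

noncomputable section

namespace BiSlant

variable {E₁ : Type*} [NormedAddCommGroup E₁] [NormedSpace ℝ E₁] [FiniteDimensional ℝ E₁]
  {N : Type*} [TopologicalSpace N] [ChartedSpace E₁ N] [IsManifold 𝓘(ℝ, E₁) ∞ N]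
  [RiemannianBundle (fun x : N => TangentSpace 𝓘(ℝ, E₁) x)]
  [IsContMDiffRiemannianBundle 𝓘(ℝ, E₁) ∞ E₁ (fun x : N => TangentSpace 𝓘(ℝ, E₁) x)]
  {E₂ : Type*} [NormedAddCommGroup E₂] [NormedSpace ℝ E₂] [FiniteDimensional ℝ E₂]
  {M : Type*} [TopologicalSpace M] [ChartedSpace E₂ M] [IsManifold 𝓘(ℝ, E₂) ∞ M]
  [RiemannianBundle (fun x : M => TangentSpace 𝓘(ℝ, E₂) x)]
  [IsContMDiffRiemannianBundle 𝓘(ℝ, E₂) ∞ E₂ (fun x : M => TangentSpace 𝓘(ℝ, E₂) x)]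
  {cov₁ : CovariantDerivative 𝓘(ℝ, E₁) E₁ (fun x : N => TangentSpace 𝓘(ℝ, E₁) x)}
  {cov₂ : CovariantDerivative 𝓘(ℝ, E₂) E₂ (fun x : M => TangentSpace 𝓘(ℝ, E₂) x)}
  {F : N → M} {X Y Z : Π p : N, TangentSpace 𝓘(ℝ, E₁) p}

omit [IsManifold 𝓘(ℝ, E₁) ∞ N] [FiniteDimensional ℝ E₂] [IsManifold 𝓘(ℝ, E₂) ∞ M]
  [IsContMDiffRiemannianBundle 𝓘(ℝ, E₁) ∞ E₁ (fun x : N => TangentSpace 𝓘(ℝ, E₁) x)]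
  [IsContMDiffRiemannianBundle 𝓘(ℝ, E₂) ∞ E₂ (fun x : M => TangentSpace 𝓘(ℝ, E₂) x)] in
-- One horizontal argument is enough: the vertical part of `v` is killed by `F_*` and orthogonal to
-- `w`.
theorem IsRiemannianMap.inner_differential (hR : IsRiemannianMap (E₁ := E₁) (E₂ := E₂) F) {p : N}
    (v : TangentSpace 𝓘(ℝ, E₁) p) {w : TangentSpace 𝓘(ℝ, E₁) p}
    (hw : w ∈ horD (E₁ := E₁) (E₂ := E₂) F p) :
    (inner ℝ (differential (E₂ := E₂) F p v) (differential F p w) : ℝ) = inner ℝ v w := by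
  rw [← hR.inner_horPart]
  exact inner_starProjection_of_mem_right _ _ hw

omit [FiniteDimensional ℝ E₁] [RiemannianBundle (fun x : N => TangentSpace 𝓘(ℝ, E₁) x)]
  [IsContMDiffRiemannianBundle 𝓘(ℝ, E₁) ∞ E₁ (fun x : N => TangentSpace 𝓘(ℝ, E₁) x)] in
theorem IsSmoothField.smoothAlongAt (hX : IsSmoothField X) (p : N) :
    SmoothAlongAt (E₁ := E₁) (fun q : N => q) X p :=
  hX.contMDiffAt

omit [FiniteDimensional ℝ E₁] [RiemannianBundle (fun x : N => TangentSpace 𝓘(ℝ, E₁) x)]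
  [IsContMDiffRiemannianBundle 𝓘(ℝ, E₁) ∞ E₁ (fun x : N => TangentSpace 𝓘(ℝ, E₁) x)] in
theorem IsSmoothField.mdiffAlongAt (hX : IsSmoothField X) (p : N) :
    MDiffAlongAt (E₁ := E₁) (fun q : N => q) X p :=
  (hX.smoothAlongAt p).mdiffAlongAt

omit [FiniteDimensional ℝ E₂] in
theorem IsSmoothField.horPart (hR : IsRiemannianMap (E₁ := E₁) (E₂ := E₂) F)
    (hX : IsSmoothField X) : IsSmoothField (fun q => BiSlant.horPart E₂ F q (X q)) :=
  fun p => (hX.smoothAlongAt p).horPart hR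

omit [FiniteDimensional ℝ E₂] in
theorem IsSmoothField.sub_horPart (hR : IsRiemannianMap (E₁ := E₁) (E₂ := E₂) F)
    (hX : IsSmoothField X) : IsSmoothField (fun q => X q - BiSlant.horPart E₂ F q (X q)) := by
  intro p
  have h := (hX.smoothAlongAt p).add contMDiff_id
    (((hX.horPart hR).smoothAlongAt p).smul contMDiff_id (f := fun _ => -1) contMDiffAt_const)
  refine Eq.mp (congrArg (fun Z => SmoothAlongAt (E₁ := E₁) (fun q : N => q) Z p)
    (funext fun q => ?_)) h
  rw [neg_one_smul, ← sub_eq_add_neg]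

omit [FiniteDimensional ℝ E₂] in
theorem exists_isSmoothField_mem_horD [T2Space N] (hR : IsRiemannianMap (E₁ := E₁) (E₂ := E₂) F)
    {p : N} {v : TangentSpace 𝓘(ℝ, E₁) p} (hv : v ∈ horD (E₁ := E₁) (E₂ := E₂) F p) :
    ∃ Z : Π p : N, TangentSpace 𝓘(ℝ, E₁) p,
      IsSmoothField Z ∧ (∀ q, Z q ∈ horD (E₁ := E₁) (E₂ := E₂) F q) ∧ Z p = v := by
  obtain ⟨Z, hZ, hZp⟩ := exists_isSmoothField v
  refine ⟨_, hZ.horPart hR, fun q => horPart_mem _, ?_⟩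
  simp only [hZp]
  exact Submodule.starProjection_eq_self_iff.2 hv

omit [FiniteDimensional ℝ E₂] in
theorem exists_isSmoothField_mem_kerD [T2Space N] (hR : IsRiemannianMap (E₁ := E₁) (E₂ := E₂) F)
    {p : N} {v : TangentSpace 𝓘(ℝ, E₁) p} (hv : v ∈ kerD (E₁ := E₁) (E₂ := E₂) F p) :
    ∃ Z : Π p : N, TangentSpace 𝓘(ℝ, E₁) p,
      IsSmoothField Z ∧ (∀ q, Z q ∈ kerD (E₁ := E₁) (E₂ := E₂) F q) ∧ Z p = v := by
  obtain ⟨Z, hZ, hZp⟩ := exists_isSmoothField v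
  refine ⟨_, hZ.sub_horPart hR, fun q => sub_horPart_mem _, ?_⟩
  simp only [hZp]
  have h : BiSlant.horPart E₂ F p v = 0 := by
    refine (Submodule.starProjection_apply_eq_zero_iff _).2 ?_
    rwa [horD, Submodule.orthogonal_orthogonal]
  rw [h, sub_zero]

omit [IsContMDiffRiemannianBundle 𝓘(ℝ, E₁) ∞ E₁ (fun x : N => TangentSpace 𝓘(ℝ, E₁) x)] in
/-- The derivative of `⟪Y, Z⟫ = 0`. -/
theorem IsLeviCivita.inner_add_inner_eq_zero (hcov₁ : IsLeviCivita cov₁) (hY : IsSmoothField Y)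
    (hZ : IsSmoothField Z) (h : ∀ q, (inner ℝ (Y q) (Z q) : ℝ) = 0) (p : N)
    (u : TangentSpace 𝓘(ℝ, E₁) p) :
    (inner ℝ (cov₁ Y p u) (Z p) : ℝ) + inner ℝ (Y p) (cov₁ Z p u) = 0 := by
  rw [← hcov₁.metric p u Y Z (hY.mdiffAlongAt p) (hZ.mdiffAlongAt p)]
  simp only [h]
  rw [mvfderiv_const]
  rfl

omit [IsContMDiffRiemannianBundle 𝓘(ℝ, E₁) ∞ E₁ (fun x : N => TangentSpace 𝓘(ℝ, E₁) x)] in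
/-- The skew-symmetry of `⟪(∇F_*)(X, Y), F_* Z⟫` in horizontal `Y` and `Z`. -/
theorem inner_secondFundamentalForm_skew (hcov₁ : IsLeviCivita cov₁) (hcov₂ : IsLeviCivita cov₂)
    (hR : IsRiemannianMap (E₁ := E₁) (E₂ := E₂) F) (hY : IsSmoothField Y) (hZ : IsSmoothField Z)
    (hYh : ∀ q, Y q ∈ horD (E₁ := E₁) (E₂ := E₂) F q)
    (hZh : ∀ q, Z q ∈ horD (E₁ := E₁) (E₂ := E₂) F q) (p : N) :
    (inner ℝ (secondFundamentalForm cov₁ cov₂ F X Y p) (differential F p (Z p)) : ℝ)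
      = -inner ℝ (secondFundamentalForm cov₁ cov₂ F X Z p) (differential F p (Y p)) := by
  have h1 := hcov₁.metric p (X p) Y Z (hY.mdiffAlongAt p) (hZ.mdiffAlongAt p)
  have h2 := pullbackCov_metric hcov₂ hR.smooth ((hY.mdiffAlongAt p).pushforward hR.smooth)
    ((hZ.mdiffAlongAt p).pushforward hR.smooth) (X p)
  -- The skew-symmetry is the derivative of this isometry identity, taken with both metric
  -- connections.
  have h3 : (fun q => (inner ℝ (pushforward (E₂ := E₂) F Y q) (pushforward F Z q) : ℝ))
      = fun q => inner ℝ (Y q) (Z q) := funext fun q => hR.isometric q _ _ (hYh q) (hZh q)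
  rw [h3, h1] at h2
  have h4 := hR.inner_differential (cov₁ Y p (X p)) (hZh p)
  have h5 := hR.inner_differential (cov₁ Z p (X p)) (hYh p)
  unfold secondFundamentalForm
  rw [inner_sub_left, inner_sub_left, h4, h5]
  simp only [pushforward] at h2 ⊢
  rw [real_inner_comm _ (Y p), real_inner_comm _ (differential (E₂ := E₂) F p (Y p))] at h2
  linarith

omit [IsContMDiffRiemannianBundle 𝓘(ℝ, E₁) ∞ E₁ (fun x : N => TangentSpace 𝓘(ℝ, E₁) x)] in
-- A trilinear form symmetric in its first two slots and skew in its last two is zero: three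
-- alternating swaps return it to itself with a sign `(-1)³`.
theorem inner_secondFundamentalForm_eq_zero (hcov₁ : IsLeviCivita cov₁)
    (hcov₂ : IsLeviCivita cov₂) (hR : IsRiemannianMap (E₁ := E₁) (E₂ := E₂) F)
    (hX : IsSmoothField X) (hY : IsSmoothField Y) (hZ : IsSmoothField Z)
    (hXh : ∀ q, X q ∈ horD (E₁ := E₁) (E₂ := E₂) F q)
    (hYh : ∀ q, Y q ∈ horD (E₁ := E₁) (E₂ := E₂) F q)
    (hZh : ∀ q, Z q ∈ horD (E₁ := E₁) (E₂ := E₂) F q) (p : N) :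
    (inner ℝ (secondFundamentalForm cov₁ cov₂ F X Y p) (differential F p (Z p)) : ℝ) = 0 := by
  have sym : ∀ {A B : Π p : N, TangentSpace 𝓘(ℝ, E₁) p}, IsSmoothField A → IsSmoothField B →
      secondFundamentalForm cov₁ cov₂ F A B p = secondFundamentalForm cov₁ cov₂ F B A p :=
    fun hA hB => secondFundamentalForm_symm hcov₁.torsion_free hcov₂.torsion_free hR.smooth
      (hA.mdiffAlongAt p) (hB.mdiffAlongAt p)
  have s1 := inner_secondFundamentalForm_skew (X := X) hcov₁ hcov₂ hR hY hZ hYh hZh p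
  have s2 := inner_secondFundamentalForm_skew (X := Z) hcov₁ hcov₂ hR hX hY hXh hYh p
  have s3 := inner_secondFundamentalForm_skew (X := Y) hcov₁ hcov₂ hR hZ hX hZh hXh p
  rw [sym hX hZ] at s1
  rw [sym hZ hY] at s2
  rw [sym hY hX] at s3
  linarith

omit [FiniteDimensional ℝ E₁] [FiniteDimensional ℝ E₂]
  [RiemannianBundle (fun x : N => TangentSpace 𝓘(ℝ, E₁) x)]
  [IsContMDiffRiemannianBundle 𝓘(ℝ, E₁) ∞ E₁ (fun x : N => TangentSpace 𝓘(ℝ, E₁) x)]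
  [RiemannianBundle (fun x : M => TangentSpace 𝓘(ℝ, E₂) x)]
  [IsContMDiffRiemannianBundle 𝓘(ℝ, E₂) ∞ E₂ (fun x : M => TangentSpace 𝓘(ℝ, E₂) x)] in
theorem secondFundamentalForm_of_mem_kerD (hF : ContMDiff 𝓘(ℝ, E₁) 𝓘(ℝ, E₂) ∞ F)
    (hY : IsSmoothField Y) (hYv : ∀ q, Y q ∈ kerD (E₁ := E₁) (E₂ := E₂) F q) (p : N) :
    secondFundamentalForm cov₁ cov₂ F X Y p = -differential F p (cov₁ Y p (X p)) := by
  have h0 : pushforward (E₂ := E₂) F Y = fun _ => 0 := funext hYv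
  have hd := (hY.mdiffAlongAt p).pushforward hF
  -- Additivity at `0 + 0 = 0` shows that the derivative of the zero field `F_* Y` vanishes.
  have h := pullbackCov_add cov₂ hF hd hd (X p)
  have h1 : (fun q => pushforward (E₂ := E₂) F Y q + pushforward F Y q) = pushforward F Y := by
    funext q
    simp [h0]
  rw [h1, left_eq_add] at h
  rw [secondFundamentalForm, h, zero_sub]


/-- The second fundamental form of two horizontal vector fields takes values in
`(range F_*)^⊥`, so that it vanishes if its normal component does. -/
theorem secondFundamentalForm_eq_zero_of_mem_horD [T2Space N] (hcov₁ : IsLeviCivita cov₁)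
    (hcov₂ : IsLeviCivita cov₂) (hR : IsRiemannianMap (E₁ := E₁) (E₂ := E₂) F)
    (hX : IsSmoothField X) (hY : IsSmoothField Y)
    (hXh : ∀ q, X q ∈ horD (E₁ := E₁) (E₂ := E₂) F q)
    (hYh : ∀ q, Y q ∈ horD (E₁ := E₁) (E₂ := E₂) F q) {p : N}
    (h : ∀ V ∈ (rangeD (E₁ := E₁) F p)ᗮ,
      (inner ℝ (pullbackCov cov₂ F (pushforward F Y) p (X p)) V : ℝ) = 0) :
    secondFundamentalForm cov₁ cov₂ F X Y p = 0 := by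
  have hn : secondFundamentalForm cov₁ cov₂ F X Y p ∈ (rangeD (E₁ := E₁) F p)ᗮ := by
    rintro _ ⟨z, rfl⟩
    obtain ⟨Z, hZ, hZh, hZp⟩ := exists_isSmoothField_mem_horD hR (horPart_mem (F := F) z)
    have h0 := inner_secondFundamentalForm_eq_zero hcov₁ hcov₂ hR hX hY hZ hXh hYh hZh p
    rw [hZp, differential_horPart] at h0
    rw [real_inner_comm]
    exact h0
  -- The form is itself a normal vector, so it can serve as the test vector `V`.
  refine inner_self_eq_zero.1 ((?_ : (inner ℝ _ _ : ℝ) = 0))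
  conv_lhs => enter [2]; rw [secondFundamentalForm]
  rw [inner_sub_left, h _ hn]
  exact (zero_sub _).trans (neg_eq_zero.2 (hn _ ⟨_, rfl⟩))

/-- The three conditions are the horizontal, vertical and mixed blocks of the symmetric form `∇F_*`;
the mixed one becomes a condition on `(ker F_*)^⊥` by metric duality. -/
theorem isTotallyGeodesicMap_iff [T2Space N] (hcov₁ : IsLeviCivita cov₁)
    (hcov₂ : IsLeviCivita cov₂) (hR : IsRiemannianMap (E₁ := E₁) (E₂ := E₂) F) :
    IsTotallyGeodesicMap cov₁ cov₂ F ↔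
      (∀ X Y : Π p : N, TangentSpace 𝓘(ℝ, E₁) p, IsSmoothField X → IsSmoothField Y →
        (∀ p, X p ∈ horD (E₂ := E₂) F p) → (∀ p, Y p ∈ horD (E₂ := E₂) F p) →
        ∀ (p : N), ∀ V ∈ (rangeD (E₁ := E₁) F p)ᗮ,
          (inner ℝ (pullbackCov cov₂ F (pushforward F Y) p (X p)) V : ℝ) = 0) ∧
      IsTotallyGeodesicDistribution cov₁ (kerD (E₂ := E₂) F) ∧
      IsTotallyGeodesicDistribution cov₁ (horD (E₂ := E₂) F) := by
  have inner_zero : ∀ {q : N} {y z : TangentSpace 𝓘(ℝ, E₁) q}, y ∈ horD (E₂ := E₂) F q →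
      z ∈ kerD (E₂ := E₂) F q → (inner ℝ y z : ℝ) = 0 := fun hy hz => by
    rw [real_inner_comm]
    exact hy _ hz
  constructor
  · intro h
    have hker : ∀ {X Y : Π p : N, TangentSpace 𝓘(ℝ, E₁) p}, IsSmoothField X → IsSmoothField Y →
        (∀ p, Y p ∈ kerD (E₂ := E₂) F p) → ∀ p, cov₁ Y p (X p) ∈ kerD (E₂ := E₂) F p := by
      intro X Y hX hY hYv p
      have h0 := h X Y hX hY p
      rw [secondFundamentalForm_of_mem_kerD hR.smooth hY hYv, neg_eq_zero] at h0
      exact h0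
    refine ⟨fun X Y hX hY _ _ p V hV => ?_, fun X Y hX hY _ hYv => hker hX hY hYv,
      fun X Y hX hY _ hYh p => ?_⟩
    · rw [sub_eq_zero.1 (h X Y hX hY p)]
      exact hV _ ⟨_, rfl⟩
    -- Test against a vertical `Z`: by `hker`, `∇_X Z` is vertical even for horizontal `X`, so `⟪∇_X
    -- Y, Z⟫ = -⟪Y, ∇_X Z⟫ = 0`.
    · intro z hz
      obtain ⟨Z, hZ, hZv, rfl⟩ := exists_isSmoothField_mem_kerD hR hz
      have h0 := hcov₁.inner_add_inner_eq_zero hY hZ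
        (fun q => inner_zero (hYh q) (hZv q)) p (X p)
      rw [inner_zero (hYh p) (hker hX hZ hZv p), add_zero] at h0
      rw [real_inner_comm]
      exact h0
  · rintro ⟨h1, h2, h3⟩ X Y hX hY p
    have hB : ∀ {X Y : Π p : N, TangentSpace 𝓘(ℝ, E₁) p}, IsSmoothField X → IsSmoothField Y →
        secondFundamentalForm cov₁ cov₂ F X Y p = secondFundamentalForm cov₁ cov₂ F Y X p :=
      fun hX hY => secondFundamentalForm_symm hcov₁.torsion_free hcov₂.torsion_free hR.smooth
        (hX.mdiffAlongAt p) (hY.mdiffAlongAt p)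
    have split : ∀ {X Y : Π p : N, TangentSpace 𝓘(ℝ, E₁) p},
        secondFundamentalForm cov₁ cov₂ F (fun q => horPart E₂ F q (X q)) Y p = 0 →
        secondFundamentalForm cov₁ cov₂ F (fun q => X q - horPart E₂ F q (X q)) Y p = 0 →
        secondFundamentalForm cov₁ cov₂ F X Y p = 0 := by
      intro X Y ha hb
      have h0 := secondFundamentalForm_add_left (cov₁ := cov₁) (cov₂ := cov₂) (F := F) (p := p)
        (X := fun q => horPart E₂ F q (X q)) (X' := fun q => X q - horPart E₂ F q (X q)) (Y := Y)
      rw [ha, hb, add_zero] at h0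
      simpa only [add_sub_cancel] using h0
    -- The mixed block: the same duality, now read from condition 3.
    have hv : ∀ {X Y : Π p : N, TangentSpace 𝓘(ℝ, E₁) p}, IsSmoothField X → IsSmoothField Y →
        (∀ p, X p ∈ horD (E₂ := E₂) F p) → (∀ p, Y p ∈ kerD (E₂ := E₂) F p) →
        secondFundamentalForm cov₁ cov₂ F X Y p = 0 := by
      intro X Y hX hY hXh hYv
      rw [secondFundamentalForm_of_mem_kerD hR.smooth hY hYv, neg_eq_zero]
      have h0 : cov₁ Y p (X p) ∈ (horD (E₁ := E₁) (E₂ := E₂) F p)ᗮ := by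
        intro z hz
        obtain ⟨Z, hZ, hZh, rfl⟩ := exists_isSmoothField_mem_horD hR hz
        have h4 := hcov₁.inner_add_inner_eq_zero hZ hY
          (fun q => inner_zero (hZh q) (hYv q)) p (X p)
        rwa [inner_zero (h3 X Z hX hZ hXh hZh p) (hYv p), zero_add] at h4
      rw [horD, Submodule.orthogonal_orthogonal] at h0
      exact h0
    have hXh := hX.horPart hR
    have hXv := hX.sub_horPart hR
    have hYh := hY.horPart hR
    have hYv := hY.sub_horPart hR
    -- `split` acts on the first slot only; the symmetry `hB` brings the second argument there.
    refine split ?_ ?_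
    · rw [hB hXh hY]
      refine split ?_ ?_
      · exact secondFundamentalForm_eq_zero_of_mem_horD hcov₁ hcov₂ hR hYh hXh
          (fun q => horPart_mem _) (fun q => horPart_mem _)
          (h1 _ _ hYh hXh (fun q => horPart_mem _) (fun q => horPart_mem _) p)
      · rw [hB hYv hXh]
        exact hv hXh hYv (fun q => horPart_mem _) fun q => sub_horPart_mem _
    · rw [hB hXv hY]
      refine split ?_ ?_
      · exact hv hYh hXv (fun q => horPart_mem _) fun q => sub_horPart_mem _
      · rw [secondFundamentalForm_of_mem_kerD hR.smooth hXv fun q => sub_horPart_mem _,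
          neg_eq_zero]
        exact h2 _ _ hYv hXv (fun q => sub_horPart_mem _) (fun q => sub_horPart_mem _) p

end BiSlant
end

/-! ### The main theorem -/

theorem theorem3p3
    {E₁ : Type*} [NormedAddCommGroup E₁] [NormedSpace ℝ E₁] [FiniteDimensional ℝ E₁]
    {N : Type*} [TopologicalSpace N] [T2Space N] [ChartedSpace E₁ N] [IsManifold 𝓘(ℝ, E₁) ∞ N]
    [RiemannianBundle (fun x : N => TangentSpace 𝓘(ℝ, E₁) x)]
    [IsContMDiffRiemannianBundle 𝓘(ℝ, E₁) ∞ E₁ (fun x : N => TangentSpace 𝓘(ℝ, E₁) x)]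
    {E₂ : Type*} [NormedAddCommGroup E₂] [NormedSpace ℝ E₂] [FiniteDimensional ℝ E₂]
    {M : Type*} [TopologicalSpace M] [T2Space M] [ChartedSpace E₂ M] [IsManifold 𝓘(ℝ, E₂) ∞ M]
    [RiemannianBundle (fun x : M => TangentSpace 𝓘(ℝ, E₂) x)]
    [IsContMDiffRiemannianBundle 𝓘(ℝ, E₂) ∞ E₂ (fun x : M => TangentSpace 𝓘(ℝ, E₂) x)]
    (cov₁ : CovariantDerivative 𝓘(ℝ, E₁) E₁ (fun x : N => TangentSpace 𝓘(ℝ, E₁) x))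
    (hcov₁ : BiSlant.IsLeviCivita cov₁)
    (cov₂ : CovariantDerivative 𝓘(ℝ, E₂) E₂ (fun x : M => TangentSpace 𝓘(ℝ, E₂) x))
    (ψ : Π x : M, TangentSpace 𝓘(ℝ, E₂) x →L[ℝ] TangentSpace 𝓘(ℝ, E₂) x)
    (ξ : Π x : M, TangentSpace 𝓘(ℝ, E₂) x)
    (η : Π x : M, TangentSpace 𝓘(ℝ, E₂) x →L[ℝ] ℝ)
    (hM : BiSlant.IsKenmotsu cov₂ ψ ξ η)
    (F : N → M)
    (D₁ D₂ : Π p : N, Submodule ℝ (TangentSpace 𝓘(ℝ, E₂) (F p))) (θ₁ θ₂ : ℝ)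
    (hF : BiSlant.IsBiSlant (E₁ := E₁) F ψ ξ D₁ D₂ θ₁ θ₂) :
    BiSlant.IsTotallyGeodesicMap cov₁ cov₂ F ↔
      (∀ X Y : Π p : N, TangentSpace 𝓘(ℝ, E₁) p,
        BiSlant.IsSmoothField X → BiSlant.IsSmoothField Y →
        (∀ p, X p ∈ BiSlant.horD (E₂ := E₂) F p) → (∀ p, Y p ∈ BiSlant.horD (E₂ := E₂) F p) →
        ∀ (p : N), ∀ V ∈ (BiSlant.rangeD (E₁ := E₁) F p)ᗮ,
          (Real.cos θ₂ ^ 2 - Real.cos θ₁ ^ 2) *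
              inner ℝ (BiSlant.pullbackCov cov₂ F
                (fun q => BiSlant.proj (D₁ q) (BiSlant.pushforward F Y q)) p (X p)) V
            = Real.cos θ₂ ^ 2 *
                inner ℝ (BiSlant.pullbackCov cov₂ F (BiSlant.pushforward F Y) p (X p)) V
              - inner ℝ (BiSlant.normalCov cov₂ F (fun q => BiSlant.norψ (E₁ := E₁) F ψ q
                  (BiSlant.tanψ (E₁ := E₁) F ψ q (BiSlant.pushforward F Y q))) p (X p)) V
              - inner ℝ (BiSlant.shapeOp cov₂ F (fun q => BiSlant.norψ (E₁ := E₁) F ψ q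
                  (BiSlant.pushforward F Y q)) p (X p)) (BiSlant.tanψ (E₁ := E₁) F ψ p V)
              + inner ℝ (BiSlant.normalCov cov₂ F (fun q => BiSlant.norψ (E₁ := E₁) F ψ q
                  (BiSlant.pushforward F Y q)) p (X p)) (BiSlant.norψ (E₁ := E₁) F ψ p V)) ∧
      BiSlant.IsTotallyGeodesicDistribution cov₁ (BiSlant.kerD (E₂ := E₂) F) ∧
      BiSlant.IsTotallyGeodesicDistribution cov₁ (BiSlant.horD (E₂ := E₂) F) := by
  have hR := hF.riemannianMap
  refine (BiSlant.isTotallyGeodesicMap_iff hcov₁ hM.leviCivita hR).trans (and_congr_left' ?_)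
  refine forall_congr' fun X => forall_congr' fun Y => forall_congr' fun _ =>
    forall_congr' fun hY => forall_congr' fun _ => forall_congr' fun _ => forall_congr' fun p =>
    forall_congr' fun V => forall_congr' fun hV => ?_
  -- The identity has the form `⟪∇^F_X F_* Y, V⟫ + lhs = rhs` with the two sides of condition 1, so
  -- that condition is equivalent to vanishing of the first term, whatever the angles.
  have h := hF.inner_pullbackCov hM ((hY.smoothAlongAt p).pushforward hR.smooth)
    (fun q => ⟨Y q, rfl⟩) (X p) hV
  constructor <;> intro h0 <;> linarith
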